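/- **Setting.** Agents $i\in\mathcal V=\{1,\dots,n\}$ observe $y^{[i]}(t)=\eta(\mathbf z^{[i]}(t))+e^{[i]}(t)$, $t=1,2,\dots$, at deterministic inputs $\mathbf z^{[i]}(t)$ in a compact set $\boldsymbol{\mathcal Z}\subset\mathbb R^{m}$, with independent noises $e^{[i]}(t)\sim\mathcal N(0,(\sigma_e^{[i]})^2)$, $\sigma_e^{[i]}\ge 0$, that are independent of $\eta$. Write $\mathcal Z^{[i]}(t)=\{\mathbf z^{[i]}(1),\dots,\mathbf z^{[i]}(t)\}$, $\rho(\mathbf z,\mathbf z')=\|\mathbf z-\mathbf z'\|$, $d^{[i]}(t)=\sup_{\mathbf z\in\boldsymbol{\mathcal Z}}\rho(\mathbf z,\mathcal Z^{[i]}(t))$, $\sigma_e^{\max}=\max_i\sigma_e^{[i]}$, $\sigma_e^{\min}=\min_i\sigma_e^{[i]}$, $\|\eta\|_{\boldsymbol{\mathcal Z}}=\sup_{\boldsymbol{\mathcal Z}}|\eta|$. The kernel is $k(\mathbf z,\mathbf z')=\kappa(\rho(\mathbf z,\mathbf z'))$ with $\kappa:[0,\infty)\to(0,\sigma_f^2]$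 continuous, non-increasing, $\kappa(0)=\sigma_f^2$, $\sigma_f>0$, and $\eta$ is on $\boldsymbol{\mathcal Z}$ a zero-mean Gaussian process with covariance $k$. *Local GPR.* For $t\ge1$, let $\mathbf p$ be a nearest point of $\mathcal Z^{[i]}(t)$ to $\mathbf z$ (any selection) and $y_{\mathbf p}$ the observation there; $\check\mu^{[i]}_{\mathbf z}(t)=\frac{k(\mathbf z,\mathbf p)}{\sigma_f^2+(\sigma_e^{[i]})^2}\,y_{\mathbf p}$ and $\check v^{[i]}_{\mathbf z}(t)=\sigma_f^2-\frac{k(\mathbf z,\mathbf p)^2}{\sigma_f^2+(\sigma_e^{[i]})^2}$; at $t=0$ these are the prior values $0$ and $\sigma_f^2$. *Distributed GPR.* With weights $A(t)=(a_{ij}(t))$ and a finite common set $\mathcal Z_{agg}\subset\boldsymbol{\mathcal Z}$, the states $\theta,\xi,\lambda$ at each point of $\mathcal Z_{agg}$ follow $x^{[i]}(0)=r^{[i]}(0)$, $x^{[i]}(t)=x^{[i]}(t-1)+\sum_{j\ne i}a_{ij}(t-1)(x^{[j]}(t-1)-x^{[i]}(t-1))+r^{[i]}(t)-r^{[i]}(t-1)$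 with $r=\check\mu/\check v$, $1/\check v$, $\check v$, respectively; $\hat v^{[i]}=1/\xi^{[i]}$, $\hat\mu^{[i]}=\hat v^{[i]}\theta^{[i]}$. *Fused GPR (RaDGPR).* $\mathcal Z^{[i]}_{agg}(t)=\{\mathbf a\in\mathcal Z_{agg}:\hat v^{[i]}_{\mathbf a}(t)<\check v^{[i]}_{\mathbf a}(t),\ \lambda^{[i]}_{\mathbf a}(t)<\check v^{[i]}_{\mathbf a}(t)\}$. If it is empty, $\tilde\mu^{[i]}_{\mathbf z}(t)=\check\mu^{[i]}_{\mathbf z}(t)$. Otherwise, with $\mathbf a$ a nearest point of $\mathcal Z^{[i]}_{agg}(t)$ to $\mathbf z$ (any selection), $$\tilde\mu^{[i]}_{\mathbf z}(t)=\check\mu^{[i]}_{\mathbf z}(t)+\frac{\min\{\check v^{[i]}_{\mathbf z}(t),\check v^{[i]}_{\mathbf a}(t)\}\max\{0,c-\psi^{[i]}\}\,k(\mathbf z,\mathbf a)}{\sigma_f^4\,\check v^{[i]}_{\mathbf a}(t)}\bigl(\hat\mu^{[i]}_{\mathbf a}(t)-\check\mu^{[i]}_{\mathbf a}(t)\bigr),$$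 where $\psi^{[i]}=\frac{\sigma_f^2}{\sigma_f^2+(\sigma_e^{[i]})^2}$, $\chi^{[i]}=\frac1{(\sigma_e^{[i]})^2}+\frac1{\sigma_f^2}$, $\mu_\chi=\frac1n\sum_i\chi^{[i]}$, $c=\mu_\chi^{-1}\frac1n\sum_j\chi^{[j]}\psi^{[j]}$. **Theorem (Accuracy improvement).** **Part I.** Suppose almost every path of $\eta$ is Lipschitz on $\boldsymbol{\mathcal Z}$ with (random) constant $\ell_\eta$. For all $\mathbf z_*\in\boldsymbol{\mathcal Z}$, $i\in\mathcal V$, $\epsilon>\sigma_e^{\max}$ and each $t\ge1$, with probability at least $1-(\sigma_e^{\max})^2/\epsilon^2$, $$|\check\mu^{[i]}_{\mathbf z_*}(t)-\eta(\mathbf z_*)|\le\Bigl(1-\frac{\kappa(d^{[i]}(t))}{\sigma_f^2+(\sigma_e^{[i]})^2}\Bigr)\|\eta\|_{\boldsymbol{\mathcal Z}}+\ell_\eta d^{[i]}(t)+\epsilon .$$ **Part II.** Suppose all $\sigma_e^{[i]}>0$ and $\sigma_f$ is chosen so that $\sigma_f^2\ge1$ and $\sum_j(\chi^{[j]}+\mu_\chi)^2/(\mu_\chi^2\,\epsilon_+)\le(\sigma_e^{\min})^2/(\sigma_e^{\max})^2$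 for the least positive value $\epsilon_+$ among $c\sigma_f^2-\psi^{[i]}$ (no condition if there is none). Suppose $d^{[i]}(t)\to0$ for all $i$; there is $b\ge1$ such that for every $t\ge 0$ the union of the graphs $\{(i,j):a_{ij}(s)\ne0\}$, $t\le s<t+b$, is strongly connected; every $A(t)$ has row and column sums $1$; there is $\alpha>0$ with $a_{ii}(t)\ge\alpha$ and $a_{ij}(t)\in\{0\}\cup[\alpha,1]$ for $i\neq j$; and the state transition matrix $\Phi(t,l)=A(t-1)\cdots A(l)$ is constant in the sense that, for each $t$, it is the same for all $1\le l<t$. Limits of $\mathcal Z^{[i]}_{agg}(t)$ are limits of sets. 1. There is a constant $C>0$, independent of $\mathbf z_*$ and $i$, such that for all $\mathbf z_*\in\boldsymbol{\mathcal Z}$ and $i\in\mathcal V$: if $\lim_{t\to\infty}\mathcal Z^{[i]}_{agg}(t)$ exists and is nonempty, and the noise variances $(\sigma_e^{[j]})^2$ are not all equal, then the two squared errors below are integrable for every $t\ge 1$ and $$\limsup_{t\to\infty}\mathbb E\bigl[(\tilde\mu^{[i]}_{\mathbf z_*}(t)-\eta(\mathbf z_*))^2-(\check\mu^{[i]}_{\mathbf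 z_*}(t)-\eta(\mathbf z_*))^2\bigr]\le-C\,\kappa(\rho(\mathbf z_*,\mathcal Z_{agg}))<0 .$$ 2. If $\lim_{t\to\infty}\mathcal Z^{[i]}_{agg}(t)=\emptyset$, or if all noise variances are equal, then for every $\mathbf z_*\in\boldsymbol{\mathcal Z}$ the squared errors $(\tilde\mu^{[i]}_{\mathbf z_*}(t)-\eta(\mathbf z_*))^2$ and $(\check\mu^{[i]}_{\mathbf z_*}(t)-\eta(\mathbf z_*))^2$ coincide surely for all sufficiently large $t$; in particular they coincide in the limit. 3. If $(\sigma_e^{[i]})^2>\frac1n\sum_j(\sigma_e^{[j]})^2$, then $\lim_{t\to\infty}\mathcal Z^{[i]}_{agg}(t)=\mathcal Z_{agg}$. 4. The limit of $\mathcal Z^{[i]}_{agg}(t)$ exists whenever $\frac{\sigma_f^2(\sigma_e^{[i]})^2}{\sigma_f^2+(\sigma_e^{[i]})^2}\ne\frac1n\sum_j\frac{\sigma_f^2(\sigma_e^{[j]})^2}{\sigma_f^2+(\sigma_e^{[j]})^2}$. -/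

import Mathlib

open MeasureTheory ProbabilityTheory Filter Topology

noncomputable section

/-- Convergence of a sequence of sets: `L` is both the limit inferior and the limit superior of
`S t` as `t → ∞`. -/
def SetLimit {α : Type*} (S : ℕ → Set α) (L : Set α) : Prop :=
  ∀ x, ∀ᶠ t in atTop, (x ∈ S t ↔ x ∈ L)

/-- State transition matrix `Φ(t, l) = A(t-1) A(t-2) ⋯ A(l)` of `x(t) = A(t-1) x(t-1)`
(equal to the identity for `t ≤ l`). -/
def stateTransition {n : ℕ} (A : ℕ → Matrix (Fin n) (Fin n) ℝ) :
    ℕ → ℕ → Matrix (Fin n) (Fin n) ℝ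
  | 0, _ => 1
  | t + 1, l => if l ≤ t then A t * stateTransition A t l else 1

/-- First-order dynamic average consensus with weights `A(t)` tracking the signals `r(t)`:
`x(0) = r(0)` and
`xᵢ(t) = xᵢ(t-1) + ∑_{j ≠ i} aᵢⱼ(t-1) (xⱼ(t-1) - xᵢ(t-1)) + rᵢ(t) - rᵢ(t-1)`. -/
def fodac {n : ℕ} (A : ℕ → Matrix (Fin n) (Fin n) ℝ) (r : ℕ → Fin n → ℝ) : ℕ → Fin n → ℝ
  | 0, i => r 0 i
  | t + 1, i => fodac A r t i
      + ∑ j ∈ Finset.univ.erase i, A t i j * (fodac A r t j - fodac A r t i)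
      + (r (t + 1) i - r t i)

/-- Data of a learning problem with `n` agents, inputs in `ℝᵐ`, and random latent function and
observation noises on `Ω`. -/
structure RaDGPR (n m : ℕ) (Ω : Type*) where
  /-- input space -/
  Z : Set (EuclideanSpace ℝ (Fin m))
  /-- common set of test points -/
  Zagg : Finset (EuclideanSpace ℝ (Fin m))
  /-- radial profile of the kernel -/
  κ : ℝ → ℝ
  /-- `σ_f` -/
  σf : ℝ
  /-- standard deviation of the observation noise of each agent -/
  σe : Fin n → ℝ
  /-- weighted adjacency matrices of the communication graphs -/
  A : ℕ → Matrix (Fin n) (Fin n) ℝ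
  /-- input sampled by agent `i` at time `t = 1, 2, …` -/
  z : Fin n → ℕ → EuclideanSpace ℝ (Fin m)
  /-- latent function -/
  η : EuclideanSpace ℝ (Fin m) → Ω → ℝ
  /-- observation noise of agent `i` at time `t` -/
  e : Fin n → ℕ → Ω → ℝ
  /-- sampling time of the nearest input selected by agent `i` at time `t` for a test point -/
  near : Fin n → ℕ → EuclideanSpace ℝ (Fin m) → ℕ
  /-- nearest point of the fusion set selected by agent `i` at time `t` for a test point -/
  nearAgg : Fin n → ℕ → EuclideanSpace ℝ (Fin m) → EuclideanSpace ℝ (Fin m)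

namespace RaDGPR

variable {n m : ℕ} {Ω : Type*} (D : RaDGPR n m Ω)

/-- The kernel `k(x, x') = κ(‖x - x'‖)`. -/
def k (x x' : EuclideanSpace ℝ (Fin m)) : ℝ := D.κ (dist x x')

/-- Observation `y⁽ⁱ⁾(t) = η(z⁽ⁱ⁾(t)) + e⁽ⁱ⁾(t)`. -/
def y (i : Fin n) (t : ℕ) (ω : Ω) : ℝ := D.η (D.z i t) ω + D.e i t ω

/-- Local input data `{z⁽ⁱ⁾(1), …, z⁽ⁱ⁾(t)}`. -/
def inputs (i : Fin n) (t : ℕ) : Set (EuclideanSpace ℝ (Fin m)) := D.z i '' Set.Icc 1 t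

/-- Dispersion `sup_{x ∈ Z} ρ(x, {z⁽ⁱ⁾(1), …, z⁽ⁱ⁾(t)})`. -/
def dispersion (i : Fin n) (t : ℕ) : ℝ := ⨆ x : D.Z, Metric.infDist (x : EuclideanSpace ℝ (Fin m)) (D.inputs i t)

/-- Supremum norm over the input space of the latent function. -/
def supNorm (ω : Ω) : ℝ := ⨆ x : D.Z, |D.η x ω|

/-- Largest noise standard deviation. -/
def σmax : ℝ := ⨆ i, D.σe i

/-- Smallest noise standard deviation. -/
def σmin : ℝ := ⨅ i, D.σe i

/-! ### Local GPR (nearest-neighbour GPR with zero prior mean) -/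

/-- Predictive mean of local GPR; the prior mean `0` without data. -/
def localMean (i : Fin n) (t : ℕ) (x : EuclideanSpace ℝ (Fin m)) (ω : Ω) : ℝ :=
  if t = 0 then 0 else
    let p := D.z i (D.near i t x)
    D.k x p * (D.k p p + D.σe i ^ 2)⁻¹ * D.y i (D.near i t x) ω

/-- Predictive variance of local GPR; the prior variance `k(x, x)` without data. -/
def localVar (i : Fin n) (t : ℕ) (x : EuclideanSpace ℝ (Fin m)) : ℝ :=
  if t = 0 then D.k x x else
    let p := D.z i (D.near i t x)
    D.k x x - D.k x p * (D.k p p + D.σe i ^ 2)⁻¹ * D.k p x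

/-! ### Distributed GPR -/

/-- Consensus state `θ`, tracking the average of (mean / variance). -/
def θ (i : Fin n) (t : ℕ) (x : EuclideanSpace ℝ (Fin m)) (ω : Ω) : ℝ :=
  fodac D.A (fun s j => (D.localVar j s x)⁻¹ * D.localMean j s x ω) t i

/-- Consensus state `ξ`, tracking the average of inverse variances. -/
def ξ (i : Fin n) (t : ℕ) (x : EuclideanSpace ℝ (Fin m)) : ℝ :=
  fodac D.A (fun s j => (D.localVar j s x)⁻¹) t i

/-- Consensus state `lam`, tracking the average of variances. -/
def lam (i : Fin n) (t : ℕ) (x : EuclideanSpace ℝ (Fin m)) : ℝ :=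
  fodac D.A (fun s j => D.localVar j s x) t i

/-- Predictive variance of distributed GPR. -/
def distVar (i : Fin n) (t : ℕ) (x : EuclideanSpace ℝ (Fin m)) : ℝ := (D.ξ i t x)⁻¹

/-- Predictive mean of distributed GPR. -/
def distMean (i : Fin n) (t : ℕ) (x : EuclideanSpace ℝ (Fin m)) (ω : Ω) : ℝ :=
  D.distVar i t x * D.θ i t x ω

/-! ### Fused GPR -/

/-- Fusion set: common test points at which both variance estimates of distributed GPR are below
the local predictive variance. -/
def fusionSet (i : Fin n) (t : ℕ) : Set (EuclideanSpace ℝ (Fin m)) :=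
  {a | a ∈ D.Zagg ∧ D.distVar i t a < D.localVar i t a ∧ D.lam i t a < D.localVar i t a}

/-- `ψ⁽ⁱ⁾ = σ_f² / (σ_f² + (σ_e⁽ⁱ⁾)²)`. -/
def ψ (i : Fin n) : ℝ := D.σf ^ 2 / (D.σf ^ 2 + D.σe i ^ 2)

/-- `χ⁽ⁱ⁾ = 1 / (σ_e⁽ⁱ⁾)² + 1 / σ_f²`. -/
def χ (i : Fin n) : ℝ := 1 / D.σe i ^ 2 + 1 / D.σf ^ 2

/-- Average of the `χ⁽ⁱ⁾`. -/
def μχ : ℝ := (∑ i, D.χ i) / n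

/-- `c = μ_χ⁻¹ (1/n) ∑ⱼ χ⁽ʲ⁾ ψ⁽ʲ⁾`. -/
def c : ℝ := D.μχ⁻¹ * ((∑ j, D.χ j * D.ψ j) / n)

/-- The factor `g` of the local cross-covariance between a test point `x` and a common point `a`. -/
def g (i : Fin n) (t : ℕ) (x a : EuclideanSpace ℝ (Fin m)) : ℝ :=
  min (D.localVar i t x) (D.localVar i t a) * max 0 (D.c - D.ψ i) / D.k x x ^ 2

/-- Fusion gain `v`. -/
def v (i : Fin n) (t : ℕ) (x : EuclideanSpace ℝ (Fin m)) : ℝ :=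
  D.g i t x (D.nearAgg i t x) * D.k x (D.nearAgg i t x) * (D.localVar i t (D.nearAgg i t x))⁻¹

open Classical in
/-- Predictive mean of RaDGPR. -/
def fusedMean (i : Fin n) (t : ℕ) (x : EuclideanSpace ℝ (Fin m)) (ω : Ω) : ℝ :=
  if D.fusionSet i t = ∅ then D.localMean i t x ω else
    D.v i t x * (D.distMean i t (D.nearAgg i t x) ω - D.localMean i t (D.nearAgg i t x) ω)
      + D.localMean i t x ω

/-! ### Standing setting and assumptions -/

/-- The standing setting: compact input space, inputs and common test points in it, admissible
nearest-neighbour selections, and independent Gaussian noises that are independent of the latent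
function on the input space. -/
structure Setting [MeasurableSpace Ω] (P : Measure Ω) : Prop where
  compact : IsCompact D.Z
  z_mem : ∀ i t, 1 ≤ t → D.z i t ∈ D.Z
  zagg_sub : (D.Zagg : Set (EuclideanSpace ℝ (Fin m))) ⊆ D.Z
  σe_nonneg : ∀ i, 0 ≤ D.σe i
  near_mem : ∀ i t, 1 ≤ t → ∀ x ∈ D.Z, D.near i t x ∈ Set.Icc 1 t
  near_dist : ∀ i t, 1 ≤ t → ∀ x ∈ D.Z,
    dist x (D.z i (D.near i t x)) = Metric.infDist x (D.inputs i t)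
  nearAgg_mem : ∀ i t, 1 ≤ t → ∀ x ∈ D.Z, (D.fusionSet i t).Nonempty →
    D.nearAgg i t x ∈ D.fusionSet i t
  nearAgg_dist : ∀ i t, 1 ≤ t → ∀ x ∈ D.Z, (D.fusionSet i t).Nonempty →
    dist x (D.nearAgg i t x) = Metric.infDist x (D.fusionSet i t)
  noise_law : ∀ i t, 1 ≤ t → HasLaw (D.e i t) (gaussianReal 0 (D.σe i ^ 2).toNNReal) P
  noise_indep : iIndepFun (fun (p : Fin n × Set.Ici (1 : ℕ)) => D.e p.1 p.2) P
  noise_indep_η : IndepFun (fun ω (x : D.Z) => D.η x ω)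
    (fun ω (p : Fin n × Set.Ici (1 : ℕ)) => D.e p.1 p.2 ω) P

/-- Kernel assumption: `κ` is continuous, positive and non-increasing on `[0, ∞)`, with
`κ(0) = σ_f²` (hence `0 < κ ≤ σ_f²`). -/
structure KernelAssumption : Prop where
  σf_pos : 0 < D.σf
  cont : ContinuousOn D.κ (Set.Ici 0)
  pos : ∀ r, 0 ≤ r → 0 < D.κ r
  le : ∀ r, 0 ≤ r → D.κ r ≤ D.σf ^ 2
  anti : AntitoneOn D.κ (Set.Ici 0)
  zero : D.κ 0 = D.σf ^ 2

/-- The latent function is, on the input space, a zero-mean Gaussian process with covariance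
function `k`. -/
structure GPAssumption [MeasurableSpace Ω] (P : Measure Ω) : Prop where
  gaussian : IsGaussianProcess (fun x : D.Z => D.η x) P
  mean : ∀ x ∈ D.Z, ∫ ω, D.η x ω ∂P = 0
  cov : ∀ x ∈ D.Z, ∀ x' ∈ D.Z, cov[D.η x, D.η x'; P] = D.k x x'

/-- Consensus assumptions: periodical strong connectivity, balanced communication and
non-degeneracy. The edges at time `s` are the pairs `(i, j)` with `aᵢⱼ(s) ≠ 0`. -/
structure ConsensusAssumption : Prop where
  connected : ∃ b : ℕ, 1 ≤ b ∧ ∀ t, ∀ i j : Fin n,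
    Relation.ReflTransGen (fun p q => ∃ s, t ≤ s ∧ s < t + b ∧ D.A s p q ≠ 0) i j
  col_sum : ∀ t j, ∑ i, D.A t i j = 1
  row_sum : ∀ t i, ∑ j, D.A t i j = 1
  nondegenerate : ∃ α : ℝ, 0 < α ∧ ∀ t, (∀ i, α ≤ D.A t i i) ∧
    ∀ i j, i ≠ j → D.A t i j = 0 ∨ (α ≤ D.A t i j ∧ D.A t i j ≤ 1)

/-- Constant state transition matrix: for each `t`, `Φ(t, l)` is the same for all starting times
`1 ≤ l < t`. -/
def ConstantTransition : Prop :=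
  ∀ t l l' : ℕ, 1 ≤ l → l < t → 1 ≤ l' → l' < t →
    stateTransition D.A t l = stateTransition D.A t l'

/-- Choice of `σ_f`: `σ_f² ≥ 1` and `σ_χ² / (μ_χ² ε₊) ≤ (σ_e^min)² / (σ_e^max)²`, where
`σ_χ² = ∑ᵢ (χ⁽ⁱ⁾ + μ_χ)²` and `ε₊` is the least positive value among `c σ_f² - ψ⁽ⁱ⁾`
(the bound for the least one is the bound for all of them). -/
structure SigmaChoice : Prop where
  one_le : 1 ≤ D.σf ^ 2
  bound : ∀ i, 0 < D.c * D.σf ^ 2 - D.ψ i →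
    (∑ j, (D.χ j + D.μχ) ^ 2) / (D.μχ ^ 2 * (D.c * D.σf ^ 2 - D.ψ i)) ≤ D.σmin ^ 2 / D.σmax ^ 2

end RaDGPR

end

/-! Part I splits the local error into shrinkage of η, displacement to the nearest input
(Lipschitz), and noise, the last bounded off an event controlled by Chebyshev's inequality.

Part II rests on two simplifications. First, constant transitions give A(t+1)A(t) = A(t+1). With
positive diagonals no edge disappears, so A(t) becomes irreducible, and its left-invariant rows must
be constant: the weights are eventually exactly 1/n (`ConsensusAssumption.eventually_uniform`). Each
consensus state is then the average of the previous signals plus one own increment. Second, the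
local variances converge to V_i = `limVar`, and c − ψ_i = (V_i − H)/σ_f² with H the harmonic mean of
the V_j (`c_sub_ψ`). The test by λ compares V_i with the arithmetic mean, which dominates H; this
governs the fusion sets, and concavity of V in the noise variance handles above-average noise.

The predictive means need not converge, since the noise used at a point changes with the nearest
input. They are therefore compared in L² with bounded idealised sequences (`AsympEq`), which is
enough for second moments. If X is the local error at x, G the distributed minus local mean at a,
and v the gain, the change of the mean squared error is 2v⟨X, G⟩ + v²‖G‖². The signal part of the
cross term is negative, the noise part is nonpositive, and the choice of σ_f bounds the noise in
‖G‖² (`SigmaChoice.quadratic_le`). The decrease is bounded away from 0 over the compact input space.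
-/

noncomputable section

/-! ### Dynamic average consensus -/

/-- A vector that is invariant under a nonnegative irreducible matrix with unit column sums, acting
from the right, is constant. -/
theorem Matrix.eq_of_vecMul_eq_self {n : ℕ} {B : Matrix (Fin n) (Fin n) ℝ} {v : Fin n → ℝ}
    (hB : ∀ i j, 0 ≤ B i j) (hcol : ∀ j, ∑ i, B i j = 1)
    (hconn : ∀ i j, Relation.ReflTransGen (fun p q => B p q ≠ 0) i j)
    (hv : ∀ j, ∑ k, v k * B k j = v j) (i j : Fin n) : v i = v j := by
  obtain ⟨q₀, -, hq₀⟩ := Finset.exists_max_image Finset.univ v ⟨i, Finset.mem_univ i⟩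
  -- Maximum principle: v q is a weighted mean of the values of v along column q, so a maximum at q
  -- spreads to every p of positive weight.
  have step : ∀ p q, B p q ≠ 0 → v q = v q₀ → v p = v q₀ := by
    intro p q hpq hq
    by_contra hne
    have hlt : v p < v q₀ := lt_of_le_of_ne (hq₀ p (Finset.mem_univ p)) hne
    have : ∑ k, v k * B k q < ∑ k, v q₀ * B k q :=
      Finset.sum_lt_sum
        (fun k _ => mul_le_mul_of_nonneg_right (hq₀ k (Finset.mem_univ k)) (hB k q))
        ⟨p, Finset.mem_univ p, mul_lt_mul_of_pos_right hlt (lt_of_le_of_ne (hB p q) hpq.symm)⟩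
    rw [hv, ← Finset.mul_sum, hcol, mul_one, hq] at this
    exact lt_irrefl _ this
  have all : ∀ p, v p = v q₀ := by
    intro p
    induction hconn p q₀ using Relation.ReflTransGen.head_induction_on with
    | refl => rfl
    | head hpq _ ih => exact step _ _ hpq ih
  rw [all i, all j]

theorem stateTransition_self {n : ℕ} (A : ℕ → Matrix (Fin n) (Fin n) ℝ) (t : ℕ) :
    stateTransition A t t = 1 := by
  cases t <;> simp [stateTransition]

theorem fodac_succ {n : ℕ} {A : ℕ → Matrix (Fin n) (Fin n) ℝ} (r : ℕ → Fin n → ℝ)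
    (hrow : ∀ t i, ∑ j, A t i j = 1) (t : ℕ) (i : Fin n) :
    fodac A r (t + 1) i = ∑ j, A t i j * fodac A r t j + (r (t + 1) i - r t i) := by
  have h : ∑ j ∈ Finset.univ.erase i, A t i j * (fodac A r t j - fodac A r t i)
      = ∑ j, A t i j * fodac A r t j - fodac A r t i := by
    rw [Finset.sum_erase _ (by simp)]
    simp only [mul_sub, Finset.sum_sub_distrib, ← Finset.sum_mul, hrow, one_mul]
  rw [fodac, h]
  ring

/-- Unit column sums make the mixing conserve the total, and the increments of the signals
telescope. -/
theorem sum_fodac {n : ℕ} {A : ℕ → Matrix (Fin n) (Fin n) ℝ} (r : ℕ → Fin n → ℝ)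
    (hcol : ∀ t j, ∑ i, A t i j = 1) (hrow : ∀ t i, ∑ j, A t i j = 1) (t : ℕ) :
    ∑ i, fodac A r t i = ∑ i, r t i := by
  induction t with
  | zero => simp [fodac]
  | succ t ih =>
    simp only [fodac_succ r hrow, Finset.sum_add_distrib, Finset.sum_sub_distrib]
    rw [Finset.sum_comm]
    simp only [← Finset.sum_mul, hcol, one_mul, ih]
    ring

theorem fodac_succ_of_uniform {n : ℕ} {A : ℕ → Matrix (Fin n) (Fin n) ℝ} (r : ℕ → Fin n → ℝ)
    (hcol : ∀ t j, ∑ i, A t i j = 1) (hrow : ∀ t i, ∑ j, A t i j = 1) {t : ℕ}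
    (hA : ∀ i j, A t i j = (n : ℝ)⁻¹) (i : Fin n) :
    fodac A r (t + 1) i = (n : ℝ)⁻¹ * ∑ j, r t j + (r (t + 1) i - r t i) := by
  rw [fodac_succ r hrow]
  simp only [hA, ← Finset.mul_sum, sum_fodac r hcol hrow]

namespace RaDGPR

variable {n m : ℕ} {Ω : Type*} {D : RaDGPR n m Ω}

/-- Compare Φ(t+2, t) with Φ(t+2, t+1). The consequence used later is that every row of the later
matrix is left-invariant under the earlier one. -/
theorem ConstantTransition.mul_eq (h : D.ConstantTransition) {t : ℕ} (ht : 1 ≤ t) :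
    D.A (t + 1) * D.A t = D.A (t + 1) := by
  have := h (t + 2) t (t + 1) ht (by omega) (by omega) (by omega)
  simpa [stateTransition, stateTransition_self] using this

theorem ConsensusAssumption.nonneg (h : D.ConsensusAssumption) (t : ℕ) (i j : Fin n) :
    0 ≤ D.A t i j := by
  obtain ⟨α, hα, hA⟩ := h.nondegenerate
  by_cases hij : i = j
  · subst hij
    exact hα.le.trans ((hA t).1 i)
  · rcases (hA t).2 i j hij with h0 | h1
    · exact h0.ge
    · exact hα.le.trans h1.1

theorem ConsensusAssumption.diag_pos (h : D.ConsensusAssumption) (t : ℕ) (i : Fin n) :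
    0 < D.A t i i := by
  obtain ⟨α, hα, hA⟩ := h.nondegenerate
  exact hα.trans_le ((hA t).1 i)

/-- With constant state transitions, edges never disappear. -/
theorem ConsensusAssumption.edge_mono (h : D.ConsensusAssumption) (hc : D.ConstantTransition)
    {s t : ℕ} (hs : 1 ≤ s) (hst : s ≤ t) {i j : Fin n} (hij : D.A s i j ≠ 0) :
    D.A t i j ≠ 0 := by
  induction t, hst using Nat.le_induction with
  | base => exact hij
  | succ t hst ih =>
    have hpos : 0 < D.A t i j := lt_of_le_of_ne (h.nonneg t i j) ih.symm
    rw [← hc.mul_eq (hs.trans hst), Matrix.mul_apply]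
    refine ((mul_pos (h.diag_pos (t + 1) i) hpos).trans_le ?_).ne'
    exact Finset.single_le_sum (f := fun k => D.A (t + 1) i k * D.A t k j)
      (fun k _ => mul_nonneg (h.nonneg _ _ _) (h.nonneg _ _ _)) (Finset.mem_univ i)

/-- With constant state transitions, the weights are eventually uniform. -/
theorem ConsensusAssumption.eventually_uniform (h : D.ConsensusAssumption)
    (hc : D.ConstantTransition) : ∀ᶠ t in atTop, ∀ i j, D.A t i j = (n : ℝ)⁻¹ := by
  obtain ⟨b, hb, hconn⟩ := h.connected
  refine eventually_atTop.2 ⟨b + 1, fun t ht i j => ?_⟩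
  obtain ⟨t, rfl⟩ : ∃ u, t = u + 1 := ⟨t - 1, by omega⟩
  have hc' : ∀ p q, Relation.ReflTransGen (fun p q => D.A t p q ≠ 0) p q := fun p q =>
    Relation.ReflTransGen.mono (fun p q ⟨s, hs1, hs2, hs⟩ => h.edge_mono hc hs1 (by omega) hs)
      _ _ (hconn 1 p q)
  have hconst := Matrix.eq_of_vecMul_eq_self (v := D.A (t + 1) i) (h.nonneg t) (h.col_sum t) hc'
    (fun j => by
      have := congrFun (congrFun (hc.mul_eq (t := t) (by omega)) i) j
      rwa [Matrix.mul_apply] at this)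
  have hsum := h.row_sum (t + 1) i
  rw [Finset.sum_congr rfl (fun k _ => hconst k j)] at hsum
  simp only [Finset.sum_const, Finset.card_univ, Fintype.card_fin, nsmul_eq_mul] at hsum
  exact eq_inv_of_mul_eq_one_right hsum

end RaDGPR

/-! ### Averages -/

/-- A bound by an affine function of the deviation from the average passes to the average. -/
theorem average_le_of_le_affine {n : ℕ} {f s : Fin n → ℝ} {f₀ m : ℝ} (hn : 0 < n)
    (h : ∀ j, f j ≤ f₀ + m * (s j - (∑ k, s k) / n)) : (∑ j, f j) / n ≤ f₀ := by
  have hn' : (0 : ℝ) < n := by exact_mod_cast hn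
  rw [div_le_iff₀ hn']
  refine (Finset.sum_le_sum fun j _ => h j).trans_eq ?_
  simp only [Finset.sum_add_distrib, ← Finset.mul_sum, Finset.sum_sub_distrib, Finset.sum_const,
    Finset.card_univ, Fintype.card_fin, nsmul_eq_mul]
  field_simp
  ring

/-- Convexity of the inverse: the left side is its tangent line at a, and the gap is an explicit
square. -/
theorem two_div_sub_le_inv {a x : ℝ} (ha : 0 < a) (hx : 0 < x) :
    a⁻¹ - (x - a) / a ^ 2 ≤ x⁻¹ := by
  have : x⁻¹ - (a⁻¹ - (x - a) / a ^ 2) = (x - a) ^ 2 / (x * a ^ 2) := by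
    field_simp
    ring
  have h2 : 0 ≤ (x - a) ^ 2 / (x * a ^ 2) := by positivity
  linarith

theorem two_div_sub_lt_inv {a x : ℝ} (ha : 0 < a) (hx : 0 < x) (hne : x ≠ a) :
    a⁻¹ - (x - a) / a ^ 2 < x⁻¹ := by
  have : x⁻¹ - (a⁻¹ - (x - a) / a ^ 2) = (x - a) ^ 2 / (x * a ^ 2) := by
    field_simp
    ring
  have h1 : x - a ≠ 0 := sub_ne_zero.2 hne
  have h2 : 0 < (x - a) ^ 2 / (x * a ^ 2) := by positivity
  linarith

/-- The harmonic mean is at most the arithmetic mean. -/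
theorem harmonic_le_average {n : ℕ} (hn : 0 < n) {V : Fin n → ℝ} (hV : ∀ j, 0 < V j) :
    ((∑ j, (V j)⁻¹) / n)⁻¹ ≤ (∑ j, V j) / n := by
  have : NeZero n := ⟨hn.ne'⟩
  have hn' : (0 : ℝ) < n := by exact_mod_cast hn
  set a := (∑ j, V j) / n with ha
  have ha0 : 0 < a := div_pos (Finset.sum_pos (fun j _ => hV j) Finset.univ_nonempty) hn'
  have h := average_le_of_le_affine (f := fun j => -(V j)⁻¹) (s := V) (f₀ := -a⁻¹)
    (m := 1 / a ^ 2) hn (fun j => by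
      have := two_div_sub_le_inv ha0 (hV j)
      rw [← ha, one_div, inv_mul_eq_div]
      linarith)
  rw [Finset.sum_neg_distrib, neg_div, neg_le_neg_iff] at h
  exact inv_le_of_inv_le₀ ha0 h

/-- The harmonic mean of values that are not all equal is below their arithmetic mean. -/
theorem harmonic_lt_average {n : ℕ} {V : Fin n → ℝ} (hV : ∀ j, 0 < V j)
    {p q : Fin n} (hpq : V p ≠ V q) :
    ((∑ j, (V j)⁻¹) / n)⁻¹ < (∑ j, V j) / n := by
  have hn : 0 < n := p.pos
  have : NeZero n := ⟨hn.ne'⟩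
  have hn' : (0 : ℝ) < n := by exact_mod_cast hn
  set a := (∑ j, V j) / n with ha
  have ha0 : 0 < a := div_pos (Finset.sum_pos (fun j _ => hV j) Finset.univ_nonempty) hn'
  obtain ⟨r, hr⟩ : ∃ r, V r ≠ a := by
    by_contra! hall
    exact hpq ((hall p).trans (hall q).symm)
  have h : ∑ j, (a⁻¹ - (V j - a) / a ^ 2) < ∑ j, (V j)⁻¹ :=
    Finset.sum_lt_sum (fun j _ => two_div_sub_le_inv ha0 (hV j))
      ⟨r, Finset.mem_univ r, two_div_sub_lt_inv ha0 (hV r) hr⟩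
  have hsum : ∑ j, (a⁻¹ - (V j - a) / a ^ 2) = n * a⁻¹ := by
    have : ∑ j, V j = n * a := by rw [ha]; field_simp
    simp only [Finset.sum_sub_distrib, ← Finset.sum_div, this, Finset.sum_const,
      Finset.card_univ, Fintype.card_fin, nsmul_eq_mul]
    simp
  rw [hsum] at h
  refine inv_lt_of_inv_lt₀ ha0 ?_
  rw [lt_div_iff₀ hn']
  linarith

namespace RaDGPR

variable {n m : ℕ} {Ω : Type*} {D : RaDGPR n m Ω}

/-! ### The kernel and the local predictive variances -/

theorem KernelAssumption.k_self (hκ : D.KernelAssumption) (x : EuclideanSpace ℝ (Fin m)) :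
    D.k x x = D.σf ^ 2 := by rw [k, dist_self, hκ.zero]

theorem k_comm (D : RaDGPR n m Ω) (x x' : EuclideanSpace ℝ (Fin m)) : D.k x x' = D.k x' x := by
  rw [k, k, dist_comm]

theorem KernelAssumption.k_pos (hκ : D.KernelAssumption) (x x' : EuclideanSpace ℝ (Fin m)) :
    0 < D.k x x' := hκ.pos _ dist_nonneg

theorem KernelAssumption.k_le (hκ : D.KernelAssumption) (x x' : EuclideanSpace ℝ (Fin m)) :
    D.k x x' ≤ D.σf ^ 2 := hκ.le _ dist_nonneg

theorem KernelAssumption.continuous_k (hκ : D.KernelAssumption) (x : EuclideanSpace ℝ (Fin m)) :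
    Continuous (D.k x) :=
  hκ.cont.comp_continuous (continuous_const.dist continuous_id) fun _ => dist_nonneg

variable [MeasurableSpace Ω] {P : Measure Ω}

theorem Setting.infDist_le_dispersion (hD : D.Setting P) (i : Fin n) {t : ℕ} (ht : 1 ≤ t)
    {x : EuclideanSpace ℝ (Fin m)} (hx : x ∈ D.Z) :
    Metric.infDist x (D.inputs i t) ≤ D.dispersion i t := by
  have hz : D.z i 1 ∈ D.inputs i t := ⟨1, ⟨le_rfl, ht⟩, rfl⟩
  refine le_ciSup (f := fun x : D.Z =>
    Metric.infDist (x : EuclideanSpace ℝ (Fin m)) (D.inputs i t)) ?_ ⟨x, hx⟩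
  refine ⟨Metric.diam D.Z, ?_⟩
  rintro _ ⟨x', rfl⟩
  exact (Metric.infDist_le_dist_of_mem hz).trans
    (Metric.dist_le_diam_of_mem hD.compact.isBounded x'.2 (hD.z_mem i 1 le_rfl))

/-- The input selected by agent `i` at time `t` for the test point `x`. -/
def nearest (D : RaDGPR n m Ω) (i : Fin n) (t : ℕ) (x : EuclideanSpace ℝ (Fin m)) :
    EuclideanSpace ℝ (Fin m) := D.z i (D.near i t x)

theorem Setting.one_le_near (hD : D.Setting P) (i : Fin n) {t : ℕ} (ht : 1 ≤ t)
    {x : EuclideanSpace ℝ (Fin m)} (hx : x ∈ D.Z) : 1 ≤ D.near i t x :=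
  (hD.near_mem i t ht x hx).1

theorem Setting.nearest_mem (hD : D.Setting P) (i : Fin n) {t : ℕ} (ht : 1 ≤ t)
    {x : EuclideanSpace ℝ (Fin m)} (hx : x ∈ D.Z) : D.nearest i t x ∈ D.Z :=
  hD.z_mem i _ (hD.one_le_near i ht hx)

theorem Setting.dist_nearest_le (hD : D.Setting P) (i : Fin n) {t : ℕ} (ht : 1 ≤ t)
    {x : EuclideanSpace ℝ (Fin m)} (hx : x ∈ D.Z) :
    dist x (D.nearest i t x) ≤ D.dispersion i t :=
  (hD.near_dist i t ht x hx).trans_le (hD.infDist_le_dispersion i ht hx)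

theorem Setting.tendsto_nearest (hD : D.Setting P) {i : Fin n}
    (hd : Tendsto (D.dispersion i) atTop (𝓝 0))
    {x : EuclideanSpace ℝ (Fin m)} (hx : x ∈ D.Z) :
    Tendsto (fun t => D.nearest i t x) atTop (𝓝 x) := by
  rw [tendsto_iff_dist_tendsto_zero]
  refine squeeze_zero' (Eventually.of_forall fun _ => dist_nonneg) ?_ hd
  filter_upwards [eventually_ge_atTop 1] with t ht
  rw [dist_comm]
  exact hD.dist_nearest_le i ht hx

/-- The factor by which local GPR scales the observation at the nearest input. -/
def gain (D : RaDGPR n m Ω) (i : Fin n) (t : ℕ) (x : EuclideanSpace ℝ (Fin m)) : ℝ :=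
  D.k x (D.nearest i t x) / (D.σf ^ 2 + D.σe i ^ 2)

omit [MeasurableSpace Ω] in
theorem KernelAssumption.localMean_eq (hκ : D.KernelAssumption) (i : Fin n) {t : ℕ} (ht : 1 ≤ t)
    (x : EuclideanSpace ℝ (Fin m)) (ω : Ω) :
    D.localMean i t x ω
      = D.gain i t x * (D.η (D.nearest i t x) ω + D.e i (D.near i t x) ω) := by
  simp only [localMean, gain, nearest, y, hκ.k_self, if_neg (show t ≠ 0 by omega)]
  rw [div_eq_mul_inv]

omit [MeasurableSpace Ω] in
theorem KernelAssumption.localVar_eq (hκ : D.KernelAssumption) (i : Fin n) {t : ℕ} (ht : 1 ≤ t)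
    (x : EuclideanSpace ℝ (Fin m)) :
    D.localVar i t x = D.σf ^ 2 - D.gain i t x * D.k x (D.nearest i t x) := by
  simp only [localVar, gain, nearest, hκ.k_self, if_neg (show t ≠ 0 by omega)]
  rw [div_eq_mul_inv, D.k_comm x]

/-- Limit of the local predictive variances as the inputs become dense. -/
def limVar (D : RaDGPR n m Ω) (i : Fin n) : ℝ :=
  D.σf ^ 2 * D.σe i ^ 2 / (D.σf ^ 2 + D.σe i ^ 2)

theorem Setting.tendsto_k_nearest (hD : D.Setting P) (hκ : D.KernelAssumption) {i : Fin n}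
    (hd : Tendsto (D.dispersion i) atTop (𝓝 0))
    {x : EuclideanSpace ℝ (Fin m)} (hx : x ∈ D.Z) :
    Tendsto (fun t => D.k x (D.nearest i t x)) atTop (𝓝 (D.σf ^ 2)) := by
  rw [← hκ.k_self x]
  exact ((hκ.continuous_k x).tendsto x).comp (hD.tendsto_nearest hd hx)

theorem Setting.tendsto_gain (hD : D.Setting P) (hκ : D.KernelAssumption) {i : Fin n}
    (hd : Tendsto (D.dispersion i) atTop (𝓝 0))
    {x : EuclideanSpace ℝ (Fin m)} (hx : x ∈ D.Z) :
    Tendsto (fun t => D.gain i t x) atTop (𝓝 (D.ψ i)) :=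
  (hD.tendsto_k_nearest hκ hd hx).div_const _

theorem Setting.tendsto_localVar (hD : D.Setting P) (hκ : D.KernelAssumption) {i : Fin n}
    (hd : Tendsto (D.dispersion i) atTop (𝓝 0))
    {x : EuclideanSpace ℝ (Fin m)} (hx : x ∈ D.Z) :
    Tendsto (fun t => D.localVar i t x) atTop (𝓝 (D.limVar i)) := by
  have h : D.limVar i = D.σf ^ 2 - D.ψ i * D.σf ^ 2 := by
    have := hκ.σf_pos
    rw [limVar, ψ]
    field_simp
    ring
  rw [h]
  refine (tendsto_const_nhds.sub
    ((hD.tendsto_gain hκ hd hx).mul (hD.tendsto_k_nearest hκ hd hx))).congr' ?_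
  filter_upwards [eventually_ge_atTop 1] with t ht
  rw [hκ.localVar_eq i ht]

/-! ### Limits of the consensus states -/

omit [MeasurableSpace Ω] in
/-- Eventually, consensus states are the average of the previous signals plus the last increment
of the agent's own signal. -/
theorem ConsensusAssumption.eventually_fodac (hc : D.ConsensusAssumption)
    (hct : D.ConstantTransition) : ∀ᶠ t in atTop, ∀ (r : ℕ → Fin n → ℝ) (i : Fin n),
      fodac D.A r (t + 1) i = (n : ℝ)⁻¹ * ∑ j, r t j + (r (t + 1) i - r t i) := by
  filter_upwards [hc.eventually_uniform hct] with t ht r i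
  exact fodac_succ_of_uniform r hc.col_sum hc.row_sum ht i

omit [MeasurableSpace Ω] in
theorem ConsensusAssumption.tendsto_fodac (hc : D.ConsensusAssumption)
    (hct : D.ConstantTransition) {r : ℕ → Fin n → ℝ} {l : Fin n → ℝ}
    (hr : ∀ j, Tendsto (fun t => r t j) atTop (𝓝 (l j))) (i : Fin n) :
    Tendsto (fun t => fodac D.A r t i) atTop (𝓝 ((∑ j, l j) / n)) := by
  rw [← tendsto_add_atTop_iff_nat 1]
  have h : Tendsto (fun t => (n : ℝ)⁻¹ * ∑ j, r t j + (r (t + 1) i - r t i)) atTop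
      (𝓝 ((n : ℝ)⁻¹ * ∑ j, l j + (l i - l i))) :=
    ((tendsto_finsetSum _ fun j _ => hr j).const_mul _).add
      (((tendsto_add_atTop_iff_nat 1).2 (hr i)).sub (hr i))
  rw [sub_self, add_zero, inv_mul_eq_div] at h
  refine h.congr' ?_
  filter_upwards [hc.eventually_fodac hct] with t ht
  exact (ht r i).symm

/-! ### Weights and gains in terms of the limiting variances -/

section Positive

variable (hκ : D.KernelAssumption) (hσ : ∀ i, 0 < D.σe i)
include hκ hσ

omit [MeasurableSpace Ω] in
theorem limVar_pos (i : Fin n) : 0 < D.limVar i := by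
  have := hκ.σf_pos
  have := hσ i
  unfold limVar
  positivity

omit [MeasurableSpace Ω] in
theorem χ_eq (i : Fin n) : D.χ i = (D.limVar i)⁻¹ := by
  have := hκ.σf_pos
  have := hσ i
  rw [limVar, χ]
  field_simp

omit [MeasurableSpace Ω] in
theorem χ_pos (i : Fin n) : 0 < D.χ i := by
  rw [χ_eq hκ hσ]
  exact inv_pos.2 (limVar_pos hκ hσ i)

omit [MeasurableSpace Ω] in
theorem χ_mul_ψ (i : Fin n) : D.χ i * D.ψ i = (D.σe i ^ 2)⁻¹ := by
  have := hκ.σf_pos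
  have := hσ i
  rw [χ, ψ]
  field_simp

omit [MeasurableSpace Ω] in
theorem ψ_eq (i : Fin n) : D.ψ i = 1 - D.limVar i / D.σf ^ 2 := by
  have := hκ.σf_pos
  have := hσ i
  rw [limVar, ψ]
  field_simp
  ring

omit [MeasurableSpace Ω] in
theorem ψ_pos (i : Fin n) : 0 < D.ψ i := by
  have := hκ.σf_pos
  have := hσ i
  unfold ψ
  positivity

omit [MeasurableSpace Ω] in
theorem ψ_lt_one (i : Fin n) : D.ψ i < 1 := by
  have := hκ.σf_pos
  have := hσ i
  rw [ψ, div_lt_one (by positivity)]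
  exact lt_add_of_pos_right _ (by positivity)

omit [MeasurableSpace Ω] in
theorem μχ_pos (hn : 0 < n) : 0 < D.μχ := by
  have : NeZero n := ⟨hn.ne'⟩
  exact div_pos (Finset.sum_pos (fun j _ => χ_pos hκ hσ j) Finset.univ_nonempty)
    (by exact_mod_cast hn)

omit [MeasurableSpace Ω] in
theorem c_eq (hn : 0 < n) : D.c = 1 - D.μχ⁻¹ / D.σf ^ 2 := by
  have hμ := μχ_pos hκ hσ hn
  have hn' : (0 : ℝ) < n := by exact_mod_cast hn
  have hf := hκ.σf_pos
  have h : ∀ j, D.χ j * D.ψ j = D.χ j - 1 / D.σf ^ 2 := fun j => by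
    rw [χ_mul_ψ hκ hσ, χ]
    ring
  have h2 : ∑ j, D.χ j = n * D.μχ := by
    rw [μχ]
    field_simp
  rw [c]
  simp only [h, Finset.sum_sub_distrib, h2, Finset.sum_const, Finset.card_univ, Fintype.card_fin,
    nsmul_eq_mul]
  field_simp

omit [MeasurableSpace Ω] in
-- Both c and ψ⁽ⁱ⁾ have the form 1 − u/σ_f², with u the harmonic mean of the limiting variances and
-- u the agent's own one. Fusion is thus active exactly for agents above the harmonic mean.
theorem c_sub_ψ (i : Fin n) : D.c - D.ψ i = (D.limVar i - D.μχ⁻¹) / D.σf ^ 2 := by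
  rw [c_eq hκ hσ i.pos, ψ_eq hκ hσ]
  ring

omit [MeasurableSpace Ω] in
theorem inv_μχ_le (hn : 0 < n) : D.μχ⁻¹ ≤ (∑ j, D.limVar j) / n := by
  have := harmonic_le_average hn (limVar_pos hκ hσ)
  simp only [← χ_eq hκ hσ] at this
  exact this

omit [MeasurableSpace Ω] in
theorem inv_μχ_lt {p q : Fin n} (hpq : D.σe p ≠ D.σe q) : D.μχ⁻¹ < (∑ j, D.limVar j) / n := by
  have hne : D.limVar p ≠ D.limVar q := by
    intro h
    have hχ : D.χ p = D.χ q := by rw [χ_eq hκ hσ, χ_eq hκ hσ, h]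
    simp only [χ, one_div, add_left_inj, inv_inj] at hχ
    exact hpq ((sq_eq_sq₀ (hσ p).le (hσ q).le).1 hχ)
  have := harmonic_lt_average (limVar_pos hκ hσ) hne
  simp only [← χ_eq hκ hσ] at this
  exact this

omit [MeasurableSpace Ω] in
/-- The limiting local variance is an increasing concave function of the noise variance. -/
theorem average_limVar_lt {i : Fin n} (hi : (∑ j, D.σe j ^ 2) / n < D.σe i ^ 2) :
    (∑ j, D.limVar j) / n < D.limVar i := by
  have hf := hκ.σf_pos
  set F := D.σf ^ 2 with hF
  have hF0 : 0 < F := by positivity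
  set s := (∑ j, D.σe j ^ 2) / n with hs
  have hs0 : 0 ≤ s := by positivity
  -- Jensen by the tangent line of u ↦ Fu/(F + u) at the mean s, with slope F²/(F + s)²; strict
  -- monotonicity then finishes.
  refine (average_le_of_le_affine (s := fun j => D.σe j ^ 2) (f₀ := F * s / (F + s))
    (m := F ^ 2 / (F + s) ^ 2) i.pos fun j => ?_).trans_lt ?_
  · have hj : 0 < D.σe j ^ 2 := by have := hσ j; positivity
    change F * D.σe j ^ 2 / (F + D.σe j ^ 2) ≤ _ + _ * (D.σe j ^ 2 - s)
    generalize D.σe j ^ 2 = u at hj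
    have : F * s / (F + s) + F ^ 2 / (F + s) ^ 2 * (u - s) - F * u / (F + u)
        = F ^ 2 * (u - s) ^ 2 / ((F + s) ^ 2 * (F + u)) := by
      field_simp
      ring
    have h2 : 0 ≤ F ^ 2 * (u - s) ^ 2 / ((F + s) ^ 2 * (F + u)) := by positivity
    linarith
  · change _ < F * D.σe i ^ 2 / (F + D.σe i ^ 2)
    have hj : 0 < D.σe i ^ 2 := hs0.trans_lt hi
    generalize D.σe i ^ 2 = u at hi hj
    rw [div_lt_div_iff₀ (by positivity) (by positivity)]
    nlinarith [mul_pos hF0 (mul_pos hF0 (sub_pos.2 hi))]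

variable (hD : D.Setting P) (hd : ∀ i, Tendsto (D.dispersion i) atTop (𝓝 0))
  (hc : D.ConsensusAssumption) (hct : D.ConstantTransition)
include hD hd hc hct

omit hσ in
theorem tendsto_lam (i : Fin n) {x : EuclideanSpace ℝ (Fin m)} (hx : x ∈ D.Z) :
    Tendsto (fun t => D.lam i t x) atTop (𝓝 ((∑ j, D.limVar j) / n)) :=
  hc.tendsto_fodac hct (fun j => hD.tendsto_localVar hκ (hd j) hx) i

omit hc hct in
theorem tendsto_inv_localVar (i : Fin n) {x : EuclideanSpace ℝ (Fin m)} (hx : x ∈ D.Z) :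
    Tendsto (fun t => (D.localVar i t x)⁻¹) atTop (𝓝 (D.χ i)) := by
  rw [χ_eq hκ hσ]
  exact (hD.tendsto_localVar hκ (hd i) hx).inv₀ (limVar_pos hκ hσ i).ne'

theorem tendsto_distVar (i : Fin n) {x : EuclideanSpace ℝ (Fin m)} (hx : x ∈ D.Z) :
    Tendsto (fun t => D.distVar i t x) atTop (𝓝 D.μχ⁻¹) :=
  (hc.tendsto_fodac hct
    (fun j => tendsto_inv_localVar hκ hσ hD hd j hx) i).inv₀ (μχ_pos hκ hσ i.pos).ne'

/-! ### Limits of the fusion sets -/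

/-- The harmonic mean is at most the arithmetic one, so passing the test by λ strictly in the limit
implies passing the other test. -/
theorem setLimit_fusionSet_zagg {i : Fin n} (hi : (∑ j, D.limVar j) / n < D.limVar i) :
    SetLimit (D.fusionSet i) (D.Zagg : Set (EuclideanSpace ℝ (Fin m))) := by
  intro x
  by_cases hx : x ∈ D.Zagg
  · have hxZ : x ∈ D.Z := hD.zagg_sub hx
    have hV := hD.tendsto_localVar hκ (hd i) hxZ
    filter_upwards [(tendsto_distVar hκ hσ hD hd hc hct i hxZ).eventually_lt hV
      ((inv_μχ_le hκ hσ i.pos).trans_lt hi),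
      (tendsto_lam hκ hD hd hc hct i hxZ).eventually_lt hV hi] with t h1 h2
    exact iff_of_true ⟨hx, h1, h2⟩ hx
  · exact Eventually.of_forall fun t => iff_of_false (fun h => hx h.1) hx

omit hσ in
theorem setLimit_fusionSet_empty {i : Fin n} (hi : D.limVar i < (∑ j, D.limVar j) / n) :
    SetLimit (D.fusionSet i) ∅ := by
  intro x
  by_cases hx : x ∈ D.Zagg
  · have hxZ : x ∈ D.Z := hD.zagg_sub hx
    filter_upwards [(hD.tendsto_localVar hκ (hd i) hxZ).eventually_lt
      (tendsto_lam hκ hD hd hc hct i hxZ) hi] with t h1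
    exact iff_of_false (fun h => h1.not_gt h.2.2) (Set.notMem_empty x)
  · exact Eventually.of_forall fun t => iff_of_false (fun h => hx h.1) (Set.notMem_empty x)

omit hσ in
-- Below the average the fusion set empties out. At a tie the limit is undecided, hence the weak
-- inequality; strictness comes later from `inv_μχ_lt`.
theorem average_le_of_mem_setLimit {i : Fin n} {L : Set (EuclideanSpace ℝ (Fin m))}
    (hL : SetLimit (D.fusionSet i) L) (hne : L.Nonempty) :
    (∑ j, D.limVar j) / n ≤ D.limVar i := by
  by_contra! hlt
  obtain ⟨x, hx⟩ := hne
  obtain ⟨t, h1, h2⟩ :=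
    ((hL x).and (setLimit_fusionSet_empty hκ hD hd hc hct hlt x)).exists
  exact (h2.1 (h1.2 hx)).elim

end Positive

omit [MeasurableSpace Ω] in
theorem setLimit_subset_zagg {i : Fin n} {L : Set (EuclideanSpace ℝ (Fin m))}
    (hL : SetLimit (D.fusionSet i) L) : L ⊆ D.Zagg := fun x hx =>
  let ⟨_, ht⟩ := (hL x).exists
  (ht.2 hx).1

omit [MeasurableSpace Ω] in
/-- Fusion sets that converge are eventually constant. -/
theorem eventually_eq_of_setLimit {i : Fin n} {L : Set (EuclideanSpace ℝ (Fin m))}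
    (hL : SetLimit (D.fusionSet i) L) : ∀ᶠ t in atTop, D.fusionSet i t = L := by
  filter_upwards [(Finset.eventually_all D.Zagg).2 fun a _ => hL a] with t ht
  ext x
  exact ⟨fun hx => (ht x hx.1).1 hx, fun hx => (ht x (setLimit_subset_zagg hL hx)).2 hx⟩

end RaDGPR

/-! ### Square integrable random variables as vectors -/

open Classical in
/-- The class in `L²` of a square integrable function, and `0` for other functions. -/
def toL2 {Ω : Type*} [MeasurableSpace Ω] (P : Measure Ω) (f : Ω → ℝ) : Lp ℝ 2 P :=
  if h : MemLp f 2 P then h.toLp f else 0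

section ToL2

variable {Ω : Type*} [MeasurableSpace Ω] {P : Measure Ω} {f g : Ω → ℝ}

theorem coeFn_toL2 (hf : MemLp f 2 P) : toL2 P f =ᵐ[P] f := by
  rw [toL2, dif_pos hf]
  exact hf.coeFn_toLp

theorem inner_toL2 (hf : MemLp f 2 P) (hg : MemLp g 2 P) :
    inner ℝ (toL2 P f) (toL2 P g) = ∫ ω, f ω * g ω ∂P := by
  rw [L2.inner_def]
  refine integral_congr_ae ?_
  filter_upwards [coeFn_toL2 hf, coeFn_toL2 hg] with ω h1 h2
  rw [h1, h2, real_inner_comm]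
  rfl

theorem toL2_add (hf : MemLp f 2 P) (hg : MemLp g 2 P) :
    toL2 P (fun ω => f ω + g ω) = toL2 P f + toL2 P g := by
  have h : MemLp (fun ω => f ω + g ω) 2 P := hf.add hg
  rw [toL2, toL2, toL2, dif_pos hf, dif_pos hg, dif_pos h]
  exact MemLp.toLp_add hf hg

theorem toL2_sub (hf : MemLp f 2 P) (hg : MemLp g 2 P) :
    toL2 P (fun ω => f ω - g ω) = toL2 P f - toL2 P g := by
  have h : MemLp (fun ω => f ω - g ω) 2 P := hf.sub hg
  rw [toL2, toL2, toL2, dif_pos hf, dif_pos hg, dif_pos h]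
  exact MemLp.toLp_sub hf hg

theorem toL2_const_mul (hf : MemLp f 2 P) (r : ℝ) :
    toL2 P (fun ω => r * f ω) = r • toL2 P f := by
  have h : MemLp (fun ω => r * f ω) 2 P := hf.const_mul r
  rw [toL2, toL2, dif_pos hf, dif_pos h]
  exact MemLp.toLp_const_smul r hf

theorem toL2_sum {ι : Type*} (s : Finset ι) {f : ι → Ω → ℝ} (hf : ∀ i, MemLp (f i) 2 P) :
    toL2 P (fun ω => ∑ i ∈ s, f i ω) = ∑ i ∈ s, toL2 P (f i) := by
  classical
  induction s using Finset.induction_on with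
  | empty =>
    simp only [Finset.sum_empty]
    have := toL2_const_mul (P := P) (f := fun _ => 0) (MemLp.zero' ) 0
    simpa using this
  | insert a s ha ih =>
    simp only [Finset.sum_insert ha]
    rw [toL2_add (hf a) (memLp_finsetSum s fun i _ => hf i), ih]

theorem memLp_fodac {n : ℕ} (A : ℕ → Matrix (Fin n) (Fin n) ℝ) {r : ℕ → Fin n → Ω → ℝ}
    (hr : ∀ t i, MemLp (r t i) 2 P) (t : ℕ) (i : Fin n) :
    MemLp (fun ω => fodac A (fun s j => r s j ω) t i) 2 P := by
  induction t generalizing i with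
  | zero => exact hr 0 i
  | succ t ih =>
    exact ((ih i).add (memLp_finsetSum _ fun j _ => ((ih j).sub (ih i)).const_mul _)).add
      ((hr _ _).sub (hr _ _))

end ToL2

namespace RaDGPR

variable {n m : ℕ} {Ω : Type*} {D : RaDGPR n m Ω} [MeasurableSpace Ω] {P : Measure Ω}

/-! ### Second moments of the latent function and of the noises -/

theorem GPAssumption.memLp (hη : D.GPAssumption P) {x : EuclideanSpace ℝ (Fin m)} (hx : x ∈ D.Z) :
    MemLp (D.η x) 2 P :=
  (hη.gaussian.hasGaussianLaw_eval ⟨x, hx⟩).memLp_two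

theorem GPAssumption.integral_mul [IsProbabilityMeasure P] (hη : D.GPAssumption P)
    {x x' : EuclideanSpace ℝ (Fin m)} (hx : x ∈ D.Z) (hx' : x' ∈ D.Z) :
    ∫ ω, D.η x ω * D.η x' ω ∂P = D.k x x' := by
  have h := covariance_eq_sub (hη.memLp hx) (hη.memLp hx')
  rw [hη.cov x hx x' hx', hη.mean x hx, zero_mul, sub_zero] at h
  exact h.symm

theorem Setting.memLp_e (hD : D.Setting P) (i : Fin n) {t : ℕ} (ht : 1 ≤ t) :
    MemLp (D.e i t) 2 P :=
  (hD.noise_law i t ht).hasGaussianLaw.memLp_two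

theorem Setting.integral_e (hD : D.Setting P) (i : Fin n) {t : ℕ} (ht : 1 ≤ t) :
    ∫ ω, D.e i t ω ∂P = 0 := by
  rw [(hD.noise_law i t ht).integral_eq, integral_id_gaussianReal]

theorem Setting.variance_e (hD : D.Setting P) (i : Fin n) {t : ℕ} (ht : 1 ≤ t) :
    Var[D.e i t; P] = D.σe i ^ 2 := by
  rw [(hD.noise_law i t ht).variance_eq, variance_id_gaussianReal, Real.coe_toNNReal _ (sq_nonneg _)]

theorem Setting.integral_e_mul_e (hD : D.Setting P) (i j : Fin n) {s t : ℕ} (hs : 1 ≤ s)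
    (ht : 1 ≤ t) :
    ∫ ω, D.e i s ω * D.e j t ω ∂P = if i = j ∧ s = t then D.σe i ^ 2 else 0 := by
  split_ifs with h
  · obtain ⟨rfl, rfl⟩ := h
    rw [← hD.variance_e i hs,
      variance_of_integral_eq_zero (hD.memLp_e i hs).aemeasurable (hD.integral_e i hs)]
    simp only [sq]
  · have hne : ((i, ⟨s, hs⟩) : Fin n × Set.Ici (1 : ℕ)) ≠ (j, ⟨t, ht⟩) := fun he =>
      h ⟨congrArg Prod.fst he, congrArg (fun p => (p.2 : ℕ)) he⟩
    have := (hD.noise_indep.indepFun hne).integral_fun_mul_eq_mul_integral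
      (hD.memLp_e i hs).aestronglyMeasurable (hD.memLp_e j ht).aestronglyMeasurable
    rw [this, hD.integral_e i hs, zero_mul]

theorem Setting.integral_η_mul_e (hD : D.Setting P) (hη : D.GPAssumption P)
    {x : EuclideanSpace ℝ (Fin m)} (hx : x ∈ D.Z) (j : Fin n) {t : ℕ} (ht : 1 ≤ t) :
    ∫ ω, D.η x ω * D.e j t ω ∂P = 0 := by
  have h : IndepFun (D.η x) (D.e j t) P :=
    hD.noise_indep_η.comp (measurable_pi_apply (⟨x, hx⟩ : D.Z))
      (measurable_pi_apply ((j, ⟨t, ht⟩) : Fin n × Set.Ici (1 : ℕ)))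
  rw [h.integral_fun_mul_eq_mul_integral (hη.memLp hx).aestronglyMeasurable
    (hD.memLp_e j ht).aestronglyMeasurable, hD.integral_e j ht, mul_zero]

/-! ### Square integrability of the predictive means -/

theorem Setting.memLp_localMean (hD : D.Setting P) (hκ : D.KernelAssumption)
    (hη : D.GPAssumption P) (i : Fin n) (t : ℕ)
    {x : EuclideanSpace ℝ (Fin m)} (hx : x ∈ D.Z) : MemLp (D.localMean i t x) 2 P := by
  -- Time 0 is needed too, because the consensus recursion starts from the prior values.
  rcases Nat.eq_zero_or_pos t with rfl | ht
  · have : D.localMean i 0 x = fun _ => 0 := by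
      ext ω
      simp [localMean]
    rw [this]
    exact MemLp.zero'
  · have : D.localMean i t x = fun ω =>
        D.gain i t x * (D.η (D.nearest i t x) ω + D.e i (D.near i t x) ω) :=
      funext fun ω => hκ.localMean_eq i ht x ω
    rw [this]
    exact ((hη.memLp (hD.nearest_mem i ht hx)).add
      (hD.memLp_e i (hD.one_le_near i ht hx))).const_mul _

theorem Setting.memLp_distMean (hD : D.Setting P) (hκ : D.KernelAssumption)
    (hη : D.GPAssumption P) (i : Fin n) (t : ℕ)
    {x : EuclideanSpace ℝ (Fin m)} (hx : x ∈ D.Z) : MemLp (D.distMean i t x) 2 P :=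
  (memLp_fodac D.A
    (fun s j => (hD.memLp_localMean hκ hη j s hx).const_mul (D.localVar j s x)⁻¹) t i).const_mul _

theorem Setting.nearAgg_mem_Z (hD : D.Setting P) {i : Fin n} {t : ℕ} (ht : 1 ≤ t)
    {x : EuclideanSpace ℝ (Fin m)} (hx : x ∈ D.Z) (hne : (D.fusionSet i t).Nonempty) :
    D.nearAgg i t x ∈ D.Z :=
  hD.zagg_sub (hD.nearAgg_mem i t ht x hx hne).1

theorem Setting.memLp_fusedMean (hD : D.Setting P) (hκ : D.KernelAssumption)
    (hη : D.GPAssumption P) (i : Fin n) {t : ℕ} (ht : 1 ≤ t)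
    {x : EuclideanSpace ℝ (Fin m)} (hx : x ∈ D.Z) : MemLp (D.fusedMean i t x) 2 P := by
  by_cases h : D.fusionSet i t = ∅
  · have : D.fusedMean i t x = D.localMean i t x := by
      ext ω
      rw [fusedMean, if_pos h]
    rw [this]
    exact hD.memLp_localMean hκ hη i t hx
  · have : D.fusedMean i t x = fun ω =>
        D.v i t x * (D.distMean i t (D.nearAgg i t x) ω - D.localMean i t (D.nearAgg i t x) ω)
          + D.localMean i t x ω := by
      ext ω
      rw [fusedMean, if_neg h]
    rw [this]
    have ha := hD.nearAgg_mem_Z ht hx (Set.nonempty_iff_ne_empty.2 h)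
    exact (((hD.memLp_distMean hκ hη i t ha).sub (hD.memLp_localMean hκ hη i t ha)).const_mul
      _).add (hD.memLp_localMean hκ hη i t hx)

/-! ### Accuracy of local GPR -/

omit [MeasurableSpace Ω] in
theorem σe_le_σmax (D : RaDGPR n m Ω) (i : Fin n) : D.σe i ≤ D.σmax :=
  le_ciSup (Set.finite_range D.σe).bddAbove i

theorem Setting.abs_localMean_sub_le (hD : D.Setting P) (hκ : D.KernelAssumption) {ω : Ω}
    {l : NNReal} (hl : LipschitzOnWith l (fun x => D.η x ω) D.Z)
    {x : EuclideanSpace ℝ (Fin m)} (hx : x ∈ D.Z) (i : Fin n) {t : ℕ} (ht : 1 ≤ t) :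
    |D.localMean i t x ω - D.η x ω| ≤
      (1 - D.κ (D.dispersion i t) / (D.σf ^ 2 + D.σe i ^ 2)) * D.supNorm ω
        + l * D.dispersion i t + |D.e i (D.near i t x) ω| := by
  have hf := hκ.σf_pos
  have hp := hD.nearest_mem i ht hx
  have hdist := hD.dist_nearest_le i ht hx
  have hsup : |D.η x ω| ≤ D.supNorm ω := by
    refine le_ciSup (f := fun x : D.Z => |D.η x ω|) ?_ ⟨x, hx⟩
    have := hD.compact.bddAbove_image (f := fun x => |D.η x ω|) hl.continuousOn.abs
    rwa [Set.image_eq_range] at this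
  have hg0 : 0 ≤ D.gain i t x := div_nonneg (hκ.k_pos _ _).le (by positivity)
  have hg1 : D.gain i t x ≤ 1 := by
    refine div_le_one_of_le₀ ((hκ.k_le _ _).trans ?_) (by positivity)
    linarith [sq_nonneg (D.σe i)]
  have hgd : D.κ (D.dispersion i t) / (D.σf ^ 2 + D.σe i ^ 2) ≤ D.gain i t x := by
    refine div_le_div_of_nonneg_right ?_ (by positivity)
    exact hκ.anti (Set.mem_Ici.2 dist_nonneg) (Set.mem_Ici.2 (dist_nonneg.trans hdist)) hdist
  have hlip : |D.η (D.nearest i t x) ω - D.η x ω| ≤ l * D.dispersion i t := by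
    have := hl.dist_le_mul _ hp _ hx
    rw [Real.dist_eq, dist_comm] at this
    exact this.trans (mul_le_mul_of_nonneg_left hdist l.2)
  rw [hκ.localMean_eq i ht]
  -- Shrinkage of η(x), displacement to the nearest input, and scaled noise.
  have hsplit : D.gain i t x * (D.η (D.nearest i t x) ω + D.e i (D.near i t x) ω) - D.η x ω
      = -((1 - D.gain i t x) * D.η x ω)
        + D.gain i t x * (D.η (D.nearest i t x) ω - D.η x ω)
        + D.gain i t x * D.e i (D.near i t x) ω := by ring
  rw [hsplit]
  refine (abs_add_three _ _ _).trans (add_le_add_three ?_ ?_ ?_)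
  · rw [abs_neg, abs_mul, abs_of_nonneg (by linarith)]
    exact mul_le_mul (by linarith) hsup (abs_nonneg _) (by linarith)
  · rw [abs_mul, abs_of_nonneg hg0]
    exact (mul_le_of_le_one_left (abs_nonneg _) hg1).trans hlip
  · rw [abs_mul, abs_of_nonneg hg0]
    exact mul_le_of_le_one_left (abs_nonneg _) hg1

theorem Setting.local_accuracy [IsProbabilityMeasure P] (hD : D.Setting P)
    (hκ : D.KernelAssumption) {l : Ω → NNReal}
    (hl : ∀ᵐ ω ∂P, LipschitzOnWith (l ω) (fun x => D.η x ω) D.Z)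
    {x : EuclideanSpace ℝ (Fin m)} (hx : x ∈ D.Z) (i : Fin n) {ε : ℝ} (hε : D.σmax < ε)
    {t : ℕ} (ht : 1 ≤ t) :
    ∃ E : Set Ω, MeasurableSet E ∧ 1 - D.σmax ^ 2 / ε ^ 2 ≤ P.real E ∧
      ∀ ω ∈ E, |D.localMean i t x ω - D.η x ω| ≤
        (1 - D.κ (D.dispersion i t) / (D.σf ^ 2 + D.σe i ^ 2)) * D.supNorm ω
          + l ω * D.dispersion i t + ε := by
  have hs := hD.one_le_near i ht hx
  have hσi : D.σe i ≤ D.σmax := σe_le_σmax D i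
  have hε0 : 0 < ε := ((hD.σe_nonneg i).trans hσi).trans_lt hε
  set s := D.near i t x with hsdef
  set B : Set Ω := {ω | ε ≤ |D.e i s ω|} ∪ {ω | ¬ LipschitzOnWith (l ω) (fun x => D.η x ω) D.Z}
    with hB
  have hPB : P B ≤ ENNReal.ofReal (D.σe i ^ 2 / ε ^ 2) := by
    -- The selected sampling time does not depend on ω, so Chebyshev applies to a single noise
    -- variable.
    have hcheb := meas_ge_le_variance_div_sq (hD.memLp_e i hs) hε0
    rw [hD.integral_e i hs, hD.variance_e i hs] at hcheb
    simp only [sub_zero] at hcheb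
    refine (measure_union_le _ _).trans ?_
    rw [ae_iff.1 hl, add_zero]
    exact hcheb
  -- The Lipschitz constant is not assumed measurable in ω, so the bad event is replaced by a
  -- measurable hull of the same measure.
  refine ⟨(toMeasurable P B)ᶜ, (measurableSet_toMeasurable P B).compl, ?_, fun ω hω => ?_⟩
  · rw [probReal_compl_eq_one_sub (measurableSet_toMeasurable P B), measureReal_def,
      measure_toMeasurable]
    refine sub_le_sub_left ?_ _
    refine (ENNReal.toReal_le_of_le_ofReal (by positivity) hPB).trans ?_
    exact div_le_div_of_nonneg_right (pow_le_pow_left₀ (hD.σe_nonneg i) hσi 2) (by positivity)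
  · have hωB : ω ∉ B := fun h => hω (subset_toMeasurable P B h)
    simp only [hB, Set.mem_union, Set.mem_ofPred_eq, not_or, not_le, not_not] at hωB
    exact (hD.abs_localMean_sub_le hκ hωB.2 hx i ht).trans (by linarith [hωB.1])

end RaDGPR

/-! ### Asymptotically equal bounded sequences of vectors -/

/-- The sequence `u` is asymptotically equal to the bounded sequence `u'`. -/
structure AsympEq {E : Type*} [NormedAddCommGroup E] (u u' : ℕ → E) : Prop where
  tendsto : Tendsto (fun t => u t - u' t) atTop (𝓝 0)
  bounded : ∃ C, ∀ᶠ t in atTop, ‖u' t‖ ≤ C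

namespace AsympEq

variable {E : Type*} [NormedAddCommGroup E] {u u' w w' : ℕ → E}

theorem add (hu : AsympEq u u') (hw : AsympEq w w') :
    AsympEq (fun t => u t + w t) (fun t => u' t + w' t) := by
  obtain ⟨C, hC⟩ := hu.bounded
  obtain ⟨K, hK⟩ := hw.bounded
  refine ⟨?_, C + K, (hC.and hK).mono fun t h => (norm_add_le _ _).trans (add_le_add h.1 h.2)⟩
  have := hu.tendsto.add hw.tendsto
  rw [add_zero] at this
  exact this.congr fun t => by abel

theorem sub (hu : AsympEq u u') (hw : AsympEq w w') :
    AsympEq (fun t => u t - w t) (fun t => u' t - w' t) := by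
  obtain ⟨C, hC⟩ := hu.bounded
  obtain ⟨K, hK⟩ := hw.bounded
  refine ⟨?_, C + K, (hC.and hK).mono fun t h => (norm_sub_le _ _).trans (add_le_add h.1 h.2)⟩
  have := hu.tendsto.sub hw.tendsto
  rw [sub_zero] at this
  exact this.congr fun t => by abel

theorem sum {ι : Type*} (s : Finset ι) {u u' : ι → ℕ → E} (h : ∀ j, AsympEq (u j) (u' j)) :
    AsympEq (fun t => ∑ j ∈ s, u j t) (fun t => ∑ j ∈ s, u' j t) := by
  choose C hC using fun j => (h j).bounded
  refine ⟨?_, ∑ j ∈ s, C j, ((Finset.eventually_all s).2 fun j _ => hC j).mono fun t h =>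
    (norm_sum_le _ _).trans (Finset.sum_le_sum h)⟩
  have := tendsto_finsetSum s fun j _ => (h j).tendsto
  rw [Finset.sum_const_zero] at this
  exact this.congr fun t => Finset.sum_sub_distrib _ _

theorem smul [NormedSpace ℝ E] (hu : AsympEq u u') {c : ℕ → ℝ} {c' : ℝ}
    (hc : Tendsto c atTop (𝓝 c')) : AsympEq (fun t => c t • u t) (fun t => c' • u' t) := by
  obtain ⟨C, hC⟩ := hu.bounded
  refine ⟨?_, ‖c'‖ * C, hC.mono fun t h => (norm_smul_le _ _).trans
    (mul_le_mul_of_nonneg_left h (norm_nonneg _))⟩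
  have h1 := hc.smul hu.tendsto
  -- The vectors u' t need not converge; boundedness suffices here.
  have h2 : Tendsto (fun t => (c t - c') • u' t) atTop (𝓝 0) := by
    refine squeeze_zero_norm' (a := fun t => ‖c t - c'‖ * C) (hC.mono fun t h =>
      (norm_smul_le _ _).trans (mul_le_mul_of_nonneg_left h (norm_nonneg _))) ?_
    have := (tendsto_iff_norm_sub_tendsto_zero.1 hc).mul_const C
    rwa [zero_mul] at this
  have := h1.add h2
  rw [smul_zero, add_zero] at this
  refine this.congr fun t => ?_
  rw [smul_sub, sub_smul]
  abel

theorem shift (hu : AsympEq u u') : AsympEq (fun t => u (t + 1)) (fun t => u' (t + 1)) :=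
  ⟨(tendsto_add_atTop_iff_nat (f := fun t => u t - u' t) 1).2 hu.tendsto,
    hu.bounded.imp fun _ h => (tendsto_add_atTop_nat 1).eventually h⟩

theorem congr {u₁ : ℕ → E} (hu : AsympEq u u') (h : u =ᶠ[atTop] u₁) : AsympEq u₁ u' :=
  ⟨hu.tendsto.congr' (h.mono fun t ht => by rw [ht]), hu.bounded⟩

/-- Expand bilinearly around u' and w'; every remaining term has a vanishing factor. Second moments
can thus be computed on the idealised sequences although neither side need converge. -/
theorem tendsto_inner [InnerProductSpace ℝ E] (hu : AsympEq u u') (hw : AsympEq w w') :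
    Tendsto (fun t => inner ℝ (u t) (w t) - inner ℝ (u' t) (w' t)) atTop (𝓝 0) := by
  obtain ⟨C, hC⟩ := hu.bounded
  obtain ⟨K, hK⟩ := hw.bounded
  have h1 := hu.tendsto.norm.mul hw.tendsto.norm
  have h2 := hu.tendsto.norm.mul_const K
  have h3 := hw.tendsto.norm.const_mul C
  rw [norm_zero, mul_zero] at h1 h3
  rw [norm_zero, zero_mul] at h2
  have h := (h1.add h2).add h3
  rw [add_zero, add_zero] at h
  refine squeeze_zero_norm' ?_ h
  filter_upwards [hC, hK] with t hCt hKt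
  have hsplit : inner ℝ (u t) (w t) - inner ℝ (u' t) (w' t)
      = inner ℝ (u t - u' t) (w t - w' t) + inner ℝ (u t - u' t) (w' t)
        + inner ℝ (u' t) (w t - w' t) := by
    simp only [inner_sub_left, inner_sub_right]
    ring
  rw [hsplit]
  refine norm_add₃_le.trans (add_le_add_three (norm_inner_le_norm _ _) ?_ ?_)
  · exact (norm_inner_le_norm _ _).trans (mul_le_mul_of_nonneg_left hKt (norm_nonneg _))
  · exact (norm_inner_le_norm _ _).trans (mul_le_mul_of_nonneg_right hCt (norm_nonneg _))

end AsympEq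

theorem norm_sq_sum_of_orthogonal {E ι : Type*} [NormedAddCommGroup E] [InnerProductSpace ℝ E]
    (s : Finset ι) {u : ι → E} (h : ∀ i j, i ≠ j → inner ℝ (u i) (u j) = 0) :
    ‖∑ i ∈ s, u i‖ ^ 2 = ∑ i ∈ s, ‖u i‖ ^ 2 := by
  rw [← real_inner_self_eq_norm_sq, sum_inner]
  refine Finset.sum_congr rfl fun i hi => ?_
  rw [inner_sum, Finset.sum_eq_single i (fun j _ hj => h i j hj.symm) (fun hi' => absurd hi hi'),
    real_inner_self_eq_norm_sq]

/-! ### Latent function, noises and local means in L² -/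

namespace RaDGPR

variable {n m : ℕ} {Ω : Type*} {D : RaDGPR n m Ω} [MeasurableSpace Ω] {P : Measure Ω}

/-- The latent function at `x` as a vector in `L²`. -/
def ηL2 (D : RaDGPR n m Ω) (P : Measure Ω) (x : EuclideanSpace ℝ (Fin m)) : Lp ℝ 2 P :=
  toL2 P (D.η x)

/-- The noise as a vector in `L²`. -/
def eL2 (D : RaDGPR n m Ω) (P : Measure Ω) (i : Fin n) (t : ℕ) : Lp ℝ 2 P := toL2 P (D.e i t)

/-- The noise of the observation used by agent `i` at time `t` for `x`, as a vector in `L²`. -/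
def nearNoise (D : RaDGPR n m Ω) (P : Measure Ω) (i : Fin n) (t : ℕ)
    (x : EuclideanSpace ℝ (Fin m)) : Lp ℝ 2 P := D.eL2 P i (D.near i t x)

theorem Setting.inner_eL2 (hD : D.Setting P) (i j : Fin n) {s t : ℕ} (hs : 1 ≤ s) (ht : 1 ≤ t) :
    inner ℝ (D.eL2 P i s) (D.eL2 P j t) = if i = j ∧ s = t then D.σe i ^ 2 else 0 := by
  rw [eL2, eL2, inner_toL2 (hD.memLp_e i hs) (hD.memLp_e j ht), hD.integral_e_mul_e i j hs ht]

theorem Setting.norm_eL2 (hD : D.Setting P) (i : Fin n) {s : ℕ} (hs : 1 ≤ s) :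
    ‖D.eL2 P i s‖ = D.σe i := by
  have h := hD.inner_eL2 i i hs hs
  rw [if_pos ⟨rfl, rfl⟩, real_inner_self_eq_norm_sq] at h
  exact (sq_eq_sq₀ (norm_nonneg _) (hD.σe_nonneg i)).1 h

theorem Setting.inner_eL2_nonneg (hD : D.Setting P) (i j : Fin n) {s t : ℕ} (hs : 1 ≤ s)
    (ht : 1 ≤ t) : 0 ≤ inner ℝ (D.eL2 P i s) (D.eL2 P j t) := by
  rw [hD.inner_eL2 i j hs ht]
  split_ifs
  · exact sq_nonneg _
  · exact le_rfl

theorem Setting.inner_ηL2_eL2 (hD : D.Setting P) (hη : D.GPAssumption P)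
    {x : EuclideanSpace ℝ (Fin m)} (hx : x ∈ D.Z) (j : Fin n) {t : ℕ} (ht : 1 ≤ t) :
    inner ℝ (D.ηL2 P x) (D.eL2 P j t) = 0 := by
  rw [eL2, ηL2, inner_toL2 (hη.memLp hx) (hD.memLp_e j ht), hD.integral_η_mul_e hη hx j ht]

variable [IsProbabilityMeasure P]

theorem GPAssumption.inner_ηL2 (hη : D.GPAssumption P)
    {x x' : EuclideanSpace ℝ (Fin m)} (hx : x ∈ D.Z) (hx' : x' ∈ D.Z) :
    inner ℝ (D.ηL2 P x) (D.ηL2 P x') = D.k x x' := by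
  rw [ηL2, ηL2, inner_toL2 (hη.memLp hx) (hη.memLp hx'), hη.integral_mul hx hx']

omit [IsProbabilityMeasure P] in
theorem Setting.toL2_localMean (hD : D.Setting P) (hκ : D.KernelAssumption)
    (hη : D.GPAssumption P) (i : Fin n) {t : ℕ} (ht : 1 ≤ t)
    {x : EuclideanSpace ℝ (Fin m)} (hx : x ∈ D.Z) :
    toL2 P (D.localMean i t x)
      = D.gain i t x • (D.ηL2 P (D.nearest i t x) + D.nearNoise P i t x) := by
  have : D.localMean i t x = fun ω =>
      D.gain i t x * (D.η (D.nearest i t x) ω + D.e i (D.near i t x) ω) :=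
    funext fun ω => hκ.localMean_eq i ht x ω
  have h1 := hη.memLp (hD.nearest_mem i ht hx)
  have h2 := hD.memLp_e i (hD.one_le_near i ht hx)
  have h3 : MemLp (fun ω => D.η (D.nearest i t x) ω + D.e i (D.near i t x) ω) 2 P := h1.add h2
  rw [this, toL2_const_mul h3, toL2_add h1 h2]
  rfl

/-- The latent function at the nearest inputs converges in `L²`. -/
theorem Setting.tendsto_ηL2_nearest (hD : D.Setting P) (hκ : D.KernelAssumption)
    (hη : D.GPAssumption P) {i : Fin n} (hd : Tendsto (D.dispersion i) atTop (𝓝 0))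
    {x : EuclideanSpace ℝ (Fin m)} (hx : x ∈ D.Z) :
    Tendsto (fun t => D.ηL2 P (D.nearest i t x) - D.ηL2 P x) atTop (𝓝 0) := by
  have h := (hD.tendsto_k_nearest hκ hd hx).const_mul 2
  have h' := (h.const_sub (2 * D.σf ^ 2)).sqrt
  rw [sub_self, Real.sqrt_zero] at h'
  refine squeeze_zero_norm' ?_ h'
  filter_upwards [eventually_ge_atTop 1] with t ht
  have hp := hD.nearest_mem i ht hx
  -- The squared L² distance of η at p and at x is 2σ_f² − 2k(x, p).
  refine Real.le_sqrt_of_sq_le (le_of_eq ?_)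
  rw [norm_sub_sq_real, ← real_inner_self_eq_norm_sq, ← real_inner_self_eq_norm_sq,
    hη.inner_ηL2 hp hp, hη.inner_ηL2 hx hx, hη.inner_ηL2 hp hx, hκ.k_self, hκ.k_self,
    D.k_comm x]
  ring

/-- The gain and the latent value converge, while the noise vector may change with the sample and is
kept as it is, with norm σ_e⁽ⁱ⁾. -/
theorem Setting.asympEq_localMean (hD : D.Setting P) (hκ : D.KernelAssumption)
    (hη : D.GPAssumption P) {i : Fin n} (hd : Tendsto (D.dispersion i) atTop (𝓝 0))
    {x : EuclideanSpace ℝ (Fin m)} (hx : x ∈ D.Z) :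
    AsympEq (fun t => toL2 P (D.localMean i t x))
      (fun t => D.ψ i • (D.ηL2 P x + D.nearNoise P i t x)) := by
  have h1 : AsympEq (fun t => D.ηL2 P (D.nearest i t x)) (fun _ => D.ηL2 P x) :=
    ⟨hD.tendsto_ηL2_nearest hκ hη hd hx, ‖D.ηL2 P x‖, Eventually.of_forall fun _ => le_rfl⟩
  have h2 : AsympEq (fun t => D.nearNoise P i t x)
      (fun t => D.nearNoise P i t x) := by
    refine ⟨by simp, D.σe i, (eventually_ge_atTop 1).mono fun t ht => ?_⟩
    exact (hD.norm_eL2 i (hD.one_le_near i ht hx)).le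
  refine ((h1.add h2).smul (hD.tendsto_gain hκ hd hx)).congr ?_
  filter_upwards [eventually_ge_atTop 1] with t ht
  rw [hD.toL2_localMean hκ hη i ht hx]

end RaDGPR

namespace RaDGPR

variable {n m : ℕ} {Ω : Type*} {D : RaDGPR n m Ω} [MeasurableSpace Ω] {P : Measure Ω}

/-! ### Asymptotics of distributed GPR -/

/-- Weight of the observation noise of agent `j` in the limit of distributed GPR, before
averaging. -/
def noiseWeight (D : RaDGPR n m Ω) (j : Fin n) : ℝ := D.μχ⁻¹ * (D.χ j * D.ψ j)

/-- Contribution of agent `j` to the noise in the difference of distributed and local GPR of agent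
`i` at time `t + 1` for the point `a`. -/
def diffNoise (D : RaDGPR n m Ω) (P : Measure Ω) (i : Fin n) (t : ℕ)
    (a : EuclideanSpace ℝ (Fin m)) (j : Fin n) : Lp ℝ 2 P :=
  ((n : ℝ)⁻¹ * D.noiseWeight j) • D.nearNoise P j t a +
    if j = i then (D.noiseWeight i - D.ψ i) • D.nearNoise P i (t + 1) a
      - D.noiseWeight i • D.nearNoise P i t a else 0

theorem Setting.eventually_toL2_distMean (hD : D.Setting P) (hκ : D.KernelAssumption)
    (hη : D.GPAssumption P) (hc : D.ConsensusAssumption) (hct : D.ConstantTransition) (i : Fin n)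
    {a : EuclideanSpace ℝ (Fin m)} (ha : a ∈ D.Z) :
    ∀ᶠ t in atTop, toL2 P (D.distMean i (t + 1) a) = D.distVar i (t + 1) a •
      ((n : ℝ)⁻¹ • ∑ j, (D.localVar j t a)⁻¹ • toL2 P (D.localMean j t a)
        + ((D.localVar i (t + 1) a)⁻¹ • toL2 P (D.localMean i (t + 1) a)
          - (D.localVar i t a)⁻¹ • toL2 P (D.localMean i t a))) := by
  filter_upwards [hc.eventually_fodac hct] with t ht
  have hL : ∀ j s, MemLp (fun ω => (D.localVar j s a)⁻¹ * D.localMean j s a ω) 2 P := fun j s =>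
    (hD.memLp_localMean hκ hη j s ha).const_mul _
  have hS : MemLp (fun ω => ∑ j, (D.localVar j t a)⁻¹ * D.localMean j t a ω) 2 P :=
    memLp_finsetSum _ fun j _ => hL j t
  have hS' : MemLp (fun ω => (n : ℝ)⁻¹ * ∑ j, (D.localVar j t a)⁻¹ * D.localMean j t a ω) 2 P :=
    hS.const_mul _
  have hI : MemLp (fun ω => (D.localVar i (t + 1) a)⁻¹ * D.localMean i (t + 1) a ω
      - (D.localVar i t a)⁻¹ * D.localMean i t a ω) 2 P := (hL i (t + 1)).sub (hL i t)
  have hT : MemLp (fun ω => (n : ℝ)⁻¹ * ∑ j, (D.localVar j t a)⁻¹ * D.localMean j t a ω +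
      ((D.localVar i (t + 1) a)⁻¹ * D.localMean i (t + 1) a ω
        - (D.localVar i t a)⁻¹ * D.localMean i t a ω)) 2 P := hS'.add hI
  have heq : D.distMean i (t + 1) a = fun ω => D.distVar i (t + 1) a *
      ((n : ℝ)⁻¹ * ∑ j, (D.localVar j t a)⁻¹ * D.localMean j t a ω +
      ((D.localVar i (t + 1) a)⁻¹ * D.localMean i (t + 1) a ω
        - (D.localVar i t a)⁻¹ * D.localMean i t a ω)) := by
    ext ω
    rw [distMean, θ, ht]
  rw [heq, toL2_const_mul hT, toL2_add hS' hI, toL2_const_mul hS,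
    toL2_sum _ (fun j => hL j t), toL2_sub (hL i (t + 1)) (hL i t),
    toL2_const_mul (hD.memLp_localMean hκ hη i (t + 1) ha),
    toL2_const_mul (hD.memLp_localMean hκ hη i t ha)]
  simp only [fun j => toL2_const_mul (hD.memLp_localMean hκ hη j t ha)]

variable (hκ : D.KernelAssumption) (hσ : ∀ i, 0 < D.σe i) (hD : D.Setting P)
include hκ hσ hD

section Noise

omit hD [MeasurableSpace Ω] in
theorem noiseWeight_nonneg (i : Fin n) : 0 ≤ D.noiseWeight i :=
  mul_nonneg (inv_nonneg.2 (μχ_pos hκ hσ i.pos).le)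
    (mul_pos (χ_pos hκ hσ i) (ψ_pos hκ hσ i)).le

omit hD [MeasurableSpace Ω] in
-- The ratio of the two sides is the harmonic mean over the agent's own limiting variance.
theorem noiseWeight_le {i : Fin n} (hi : D.μχ⁻¹ ≤ D.limVar i) : D.noiseWeight i ≤ D.ψ i := by
  have hμ := μχ_pos hκ hσ i.pos
  have hV := limVar_pos hκ hσ i
  rw [noiseWeight, ← mul_assoc]
  refine mul_le_of_le_one_left (ψ_pos hκ hσ i).le ?_
  rw [χ_eq hκ hσ]
  exact (mul_le_mul_of_nonneg_right hi (inv_pos.2 hV).le).trans_eq (mul_inv_cancel₀ hV.ne')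

omit hD [MeasurableSpace Ω] in
theorem average_noiseWeight_le (j : Fin n) : (n : ℝ)⁻¹ * D.noiseWeight j ≤ 1 := by
  have hn : (0 : ℝ) < n := by exact_mod_cast j.pos
  have hS : 0 < ∑ k, D.χ k := by
    have := μχ_pos hκ hσ j.pos
    rw [μχ] at this
    exact (div_pos_iff_of_pos_right hn).1 this
  have hle : D.χ j ≤ ∑ k, D.χ k :=
    Finset.single_le_sum (fun k _ => (χ_pos hκ hσ k).le) (Finset.mem_univ j)
  have : (n : ℝ)⁻¹ * D.noiseWeight j = D.χ j / (∑ k, D.χ k) * D.ψ j := by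
    rw [noiseWeight, μχ]
    field_simp
  rw [this]
  exact mul_le_one₀ ((div_le_one hS).2 hle) (ψ_pos hκ hσ j).le (ψ_lt_one hκ hσ j).le

/-- Only agent i's own noise correlates with its error. Its coefficients (1/n − 1)w at time t and w
− ψ at time t + 1, w the noise weight, are nonpositive, so the sign holds whichever samples
coincide. -/
theorem inner_nearNoise_sum_diffNoise_le {i : Fin n} (hi : D.μχ⁻¹ ≤ D.limVar i) {s t : ℕ}
    (hs : 1 ≤ s) (ht : 1 ≤ t) {a : EuclideanSpace ℝ (Fin m)} (ha : a ∈ D.Z) :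
    inner ℝ (D.eL2 P i s) (∑ j, D.diffNoise P i t a j) ≤ 0 := by
  have hw0 := noiseWeight_nonneg hκ hσ i
  have hw1 := noiseWeight_le hκ hσ hi
  have hn : (n : ℝ)⁻¹ ≤ 1 := inv_le_one_of_one_le₀ (by exact_mod_cast i.pos)
  have h1 := hD.inner_eL2_nonneg i i hs (hD.one_le_near i ht ha)
  have h2 := hD.inner_eL2_nonneg i i hs (hD.one_le_near i (Nat.le_add_left 1 t) ha)
  rw [inner_sum, Finset.sum_eq_single i]
  · simp only [diffNoise, if_true, nearNoise, inner_add_right, inner_sub_right, inner_smul_right]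
    nlinarith [mul_nonneg (mul_nonneg (sub_nonneg.2 hn) hw0) h1, mul_nonneg (sub_nonneg.2 hw1) h2]
  · intro j _ hj
    rw [diffNoise, if_neg hj, add_zero, inner_smul_right, nearNoise,
      hD.inner_eL2 i j hs (hD.one_le_near j ht ha), if_neg fun h => hj h.1.symm, mul_zero]
  · exact fun h => absurd (Finset.mem_univ i) h

theorem norm_diffNoise_le {i : Fin n} (hi : D.μχ⁻¹ ≤ D.limVar i) {t : ℕ} (ht : 1 ≤ t)
    {a : EuclideanSpace ℝ (Fin m)} (ha : a ∈ D.Z) (j : Fin n) :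
    ‖D.diffNoise P i t a j‖ ≤ D.σe j := by
  have hN : ∀ k, ‖D.nearNoise P k t a‖ = D.σe k := fun k =>
    hD.norm_eL2 k (hD.one_le_near k ht ha)
  by_cases hj : j = i
  · subst hj
    have hN' : ‖D.nearNoise P j (t + 1) a‖ = D.σe j :=
      hD.norm_eL2 j (hD.one_le_near j (Nat.le_add_left 1 t) ha)
    have hw0 := noiseWeight_nonneg hκ hσ j
    have hw1 := noiseWeight_le hκ hσ hi
    have hn0 : 0 ≤ (n : ℝ)⁻¹ := by positivity
    have hn : (n : ℝ)⁻¹ ≤ 1 := inv_le_one_of_one_le₀ (by exact_mod_cast j.pos)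
    -- The two coefficients have absolute values summing to ψ − w/n < 1, w the noise weight, so the
    -- triangle inequality suffices even if the two samples coincide.
    have heq : D.diffNoise P j t a j
        = -(((1 - (n : ℝ)⁻¹) * D.noiseWeight j) • D.nearNoise P j t a)
          - (D.ψ j - D.noiseWeight j) • D.nearNoise P j (t + 1) a := by
      rw [diffNoise, if_pos rfl]
      module
    rw [heq]
    refine (norm_sub_le _ _).trans ?_
    rw [norm_neg, norm_smul, norm_smul, hN, hN', Real.norm_of_nonneg
      (mul_nonneg (sub_nonneg.2 hn) hw0), Real.norm_of_nonneg (sub_nonneg.2 hw1), ← add_mul]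
    refine mul_le_of_le_one_left (hσ j).le ?_
    nlinarith [ψ_lt_one hκ hσ j, mul_nonneg hn0 hw0]
  · rw [diffNoise, if_neg hj, add_zero, norm_smul, hN, Real.norm_of_nonneg
      (mul_nonneg (by positivity) (noiseWeight_nonneg hκ hσ j))]
    exact mul_le_of_le_one_left (hσ j).le (average_noiseWeight_le hκ hσ j)

omit hκ hσ in
theorem inner_diffNoise_of_ne (i : Fin n) {t : ℕ} (ht : 1 ≤ t)
    {a : EuclideanSpace ℝ (Fin m)} (ha : a ∈ D.Z) {j k : Fin n} (hjk : j ≠ k) :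
    inner ℝ (D.diffNoise P i t a j) (D.diffNoise P i t a k) = 0 := by
  have h : ∀ {s r : ℕ} {p q : Fin n}, 1 ≤ s → 1 ≤ r → p ≠ q →
      inner ℝ (D.nearNoise P p s a) (D.nearNoise P q r a) = 0 := fun hs hr hpq => by
    rw [nearNoise, nearNoise, hD.inner_eL2 _ _ (hD.one_le_near _ hs ha) (hD.one_le_near _ hr ha),
      if_neg fun h => hpq h.1]
  have ht' : 1 ≤ t + 1 := Nat.le_add_left 1 t
  by_cases hj : j = i
  · subst hj
    simp [diffNoise, hjk.symm, inner_add_left, inner_sub_left, inner_smul_left, inner_smul_right,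
      h ht ht hjk, h ht' ht hjk]
  · by_cases hk : k = i
    · subst hk
      simp [diffNoise, hj, inner_add_right, inner_sub_right, inner_smul_left, inner_smul_right,
        h ht ht hjk, h ht ht' hjk]
    · simp [diffNoise, hj, hk, inner_smul_left, inner_smul_right, h ht ht hjk]

theorem norm_sq_sum_diffNoise_le {i : Fin n} (hi : D.μχ⁻¹ ≤ D.limVar i) {t : ℕ} (ht : 1 ≤ t)
    {a : EuclideanSpace ℝ (Fin m)} (ha : a ∈ D.Z) :
    ‖∑ j, D.diffNoise P i t a j‖ ^ 2 ≤ n * D.σmax ^ 2 := by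
  rw [norm_sq_sum_of_orthogonal _ fun j k hjk => inner_diffNoise_of_ne hD i ht ha hjk]
  refine (Finset.sum_le_sum fun j _ => pow_le_pow_left₀ (norm_nonneg _)
    ((norm_diffNoise_le hκ hσ hD hi ht ha j).trans (σe_le_σmax D j)) 2).trans_eq ?_
  simp

end Noise

variable [IsProbabilityMeasure P] (hη : D.GPAssumption P)
  (hd : ∀ i, Tendsto (D.dispersion i) atTop (𝓝 0))
  (hc : D.ConsensusAssumption) (hct : D.ConstantTransition)
include hη hd hc hct

/-- Asymptotics of the difference of distributed and local GPR. -/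
theorem asympEq_distMean_sub_localMean (i : Fin n) {a : EuclideanSpace ℝ (Fin m)}
    (ha : a ∈ D.Z) :
    AsympEq (fun t => toL2 P (D.distMean i (t + 1) a) - toL2 P (D.localMean i (t + 1) a))
      (fun t => (D.c - D.ψ i) • D.ηL2 P a + ∑ j, D.diffNoise P i t a j) := by
  have hM := fun j => hD.asympEq_localMean hκ hη (hd j) ha
  have hR := fun j => (hM j).smul (tendsto_inv_localVar hκ hσ hD hd j ha)
  -- The own increment contributes no η(a) in the limit, but the noises at times t and t + 1 may
  -- differ and survive.
  have hT := (((AsympEq.sum Finset.univ hR).smul (tendsto_const_nhds (x := (n : ℝ)⁻¹))).add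
    ((hR i).shift.sub (hR i))).smul
    ((tendsto_add_atTop_iff_nat 1).2 (tendsto_distVar hκ hσ hD hd hc hct i ha))
  have hfin := (hT.congr ((hD.eventually_toL2_distMean hκ hη hc hct i ha).mono
    fun t ht => ht.symm)).sub (hM i).shift
  convert hfin using 2 with t
  have h1 : ∑ j, D.diffNoise P i t a j
      = ∑ j, ((n : ℝ)⁻¹ * D.noiseWeight j) • D.nearNoise P j t a +
        ((D.noiseWeight i - D.ψ i) • D.nearNoise P i (t + 1) a
          - D.noiseWeight i • D.nearNoise P i t a) := by
    simp only [diffNoise, Finset.sum_add_distrib, Finset.sum_ite_eq', Finset.mem_univ, if_true]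
  have h2 : ∑ j, D.χ j • D.ψ j • (D.ηL2 P a + D.nearNoise P j t a)
      = (∑ j, D.χ j * D.ψ j) • D.ηL2 P a + ∑ j, (D.χ j * D.ψ j) • D.nearNoise P j t a := by
    simp only [smul_add, Finset.sum_add_distrib, Finset.sum_smul, smul_smul]
  have h3 : ∑ j, ((n : ℝ)⁻¹ * D.noiseWeight j) • D.nearNoise P j t a
      = ((n : ℝ)⁻¹ * D.μχ⁻¹) • ∑ j, (D.χ j * D.ψ j) • D.nearNoise P j t a := by
    rw [Finset.smul_sum]
    refine Finset.sum_congr rfl fun j _ => ?_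
    rw [smul_smul, noiseWeight]
    congr 1
    ring
  rw [h1, h2, h3, c, noiseWeight, div_eq_inv_mul]
  module

omit hσ hc hct in
/-- Asymptotics of the error of local GPR. -/
theorem asympEq_localMean_sub_η (i : Fin n) {x : EuclideanSpace ℝ (Fin m)} (hx : x ∈ D.Z) :
    AsympEq (fun t => toL2 P (D.localMean i (t + 1) x) - D.ηL2 P x)
      (fun t => (D.ψ i - 1) • D.ηL2 P x + D.ψ i • D.nearNoise P i (t + 1) x) := by
  have h1 : AsympEq (fun _ : ℕ => D.ηL2 P x) (fun _ => D.ηL2 P x) :=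
    ⟨by simp, ‖D.ηL2 P x‖, Eventually.of_forall fun _ => le_rfl⟩
  convert (hD.asympEq_localMean hκ hη (hd i) hx).shift.sub h1 using 2 with t
  module

end RaDGPR

namespace RaDGPR

variable {n m : ℕ} {Ω : Type*} {D : RaDGPR n m Ω} [MeasurableSpace Ω] {P : Measure Ω}

/-! ### Accuracy of fused GPR -/

/-- Fusion gain at `x` relative to the common point `a`. -/
def gainAt (D : RaDGPR n m Ω) (i : Fin n) (t : ℕ) (x a : EuclideanSpace ℝ (Fin m)) : ℝ :=
  D.g i t x a * D.k x a * (D.localVar i t a)⁻¹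

/-- Asymptotic decrease, up to a factor `2`, of the mean squared error by fusion with `a`. -/
def decrease (D : RaDGPR n m Ω) (i : Fin n) (x a : EuclideanSpace ℝ (Fin m)) : ℝ :=
  (D.c - D.ψ i) ^ 2 * D.k x a ^ 2 / (D.σf ^ 2) ^ 2 * ((1 - D.ψ i) * D.ψ i)

theorem integral_sq_sub_sq {f g : Ω → ℝ} (hf : MemLp f 2 P) (hg : MemLp g 2 P) (v : ℝ) :
    ∫ ω, ((v * g ω + f ω) ^ 2 - f ω ^ 2) ∂P
      = 2 * inner ℝ (toL2 P f) (v • toL2 P g) + inner ℝ (v • toL2 P g) (v • toL2 P g) := by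
  have h1 : Integrable (fun ω => f ω * g ω) P := hf.integrable_mul hg
  have h2 : Integrable (fun ω => g ω * g ω) P := hg.integrable_mul hg
  have h : ∀ ω, (v * g ω + f ω) ^ 2 - f ω ^ 2 = 2 * v * (f ω * g ω) + v ^ 2 * (g ω * g ω) :=
    fun ω => by ring
  simp only [h, real_inner_smul_left, real_inner_smul_right, inner_toL2 hf hg, inner_toL2 hg hg]
  rw [integral_add (h1.const_mul _) (h2.const_mul _), integral_const_mul, integral_const_mul]
  ring

section

variable (hκ : D.KernelAssumption) (hσ : ∀ i, 0 < D.σe i)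
include hκ hσ

omit [MeasurableSpace Ω] in
/-- The choice of `σ_f` bounds the total noise of distributed GPR. -/
theorem SigmaChoice.noise_le (hs : D.SigmaChoice) {i : Fin n} (hi : D.μχ⁻¹ ≤ D.limVar i)
    (hw : 0 < D.c - D.ψ i) : n * D.σmax ^ 2 / (D.σf ^ 2) ^ 2 ≤ 1 - D.ψ i := by
  have hF := hs.one_le
  have hn : (0 : ℝ) < n := by exact_mod_cast i.pos
  have hμ := μχ_pos hκ hσ i.pos
  have hψ := ψ_pos hκ hσ i
  have hσmax : 0 < D.σmax := (hσ i).trans_le (σe_le_σmax D i)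
  have hσmin : ∀ j, D.σmin ≤ D.σe j := fun j => ciInf_le (Set.finite_range D.σe).bddBelow j
  have hσmin0 : 0 ≤ D.σmin := Real.iInf_nonneg fun j => (hσ j).le
  -- Since σ_f² ≥ 1, an agent with c > ψ⁽ⁱ⁾ is among those to which the choice of σ_f applies.
  have hpos : 0 < D.c * D.σf ^ 2 - D.ψ i := by nlinarith
  have hsum : n * D.μχ ^ 2 ≤ ∑ j, (D.χ j + D.μχ) ^ 2 := by
    have : ∑ _j : Fin n, D.μχ ^ 2 = n * D.μχ ^ 2 := by simp
    rw [← this]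
    exact Finset.sum_le_sum fun j _ =>
      pow_le_pow_left₀ hμ.le (le_add_of_nonneg_left (χ_pos hκ hσ j).le) 2
  have hb := hs.bound i hpos
  rw [div_le_div_iff₀ (by positivity) (by positivity)] at hb
  have h1 : n * D.σmax ^ 2 ≤ D.σmin ^ 2 * (D.c * D.σf ^ 2 - D.ψ i) := by
    have h := (mul_le_mul_of_nonneg_right hsum (sq_nonneg D.σmax)).trans hb
    have hμ2 : 0 < D.μχ ^ 2 := by positivity
    refine le_of_mul_le_mul_right ?_ hμ2
    linarith
  -- Here c is the average of 1/(σ_e⁽ʲ⁾)² divided by μ_χ, so c(σ_e^min)² is at most the harmonic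
  -- mean.
  have h2 : D.c * D.σmin ^ 2 ≤ D.limVar i := by
    refine le_trans ?_ hi
    rw [c, mul_assoc]
    refine mul_le_of_le_one_right (inv_pos.2 hμ).le ?_
    rw [div_mul_eq_mul_div, div_le_one hn, Finset.sum_mul]
    refine (Finset.sum_le_sum (g := fun _ => (1 : ℝ)) fun j _ => ?_).trans_eq (by simp)
    rw [χ_mul_ψ hκ hσ, inv_mul_le_one₀ (by have := hσ j; positivity)]
    exact pow_le_pow_left₀ hσmin0 (hσmin j) 2
  have h3 : 1 - D.ψ i = D.limVar i / D.σf ^ 2 := by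
    rw [ψ_eq hκ hσ]
    ring
  have hF0 : 0 < D.σf ^ 2 := by linarith
  rw [h3, div_le_div_iff₀ (by positivity) hF0]
  have h4 : D.σmin ^ 2 * (D.c * D.σf ^ 2 - D.ψ i) ≤ D.limVar i * D.σf ^ 2 := by
    have := mul_le_mul_of_nonneg_right h2 hF0.le
    nlinarith [mul_nonneg (sq_nonneg D.σmin) hψ.le]
  nlinarith

omit [MeasurableSpace Ω] in
theorem decrease_pos {i : Fin n} (hw : 0 < D.c - D.ψ i) (x a : EuclideanSpace ℝ (Fin m)) :
    0 < D.decrease i x a := by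
  have h1 := hκ.k_pos x a
  have h2 := ψ_pos hκ hσ i
  have h3 := sub_pos.2 (ψ_lt_one hκ hσ i)
  have h4 := hκ.σf_pos
  unfold decrease
  positivity

omit [MeasurableSpace Ω] in
-- The quadratic change of the mean squared error at the limiting gain: p is the noise correlation
-- and N the noise energy of the correction.
theorem SigmaChoice.quadratic_le (hs : D.SigmaChoice) {i : Fin n} (hi : D.μχ⁻¹ ≤ D.limVar i)
    (hw : 0 < D.c - D.ψ i) (x a : EuclideanSpace ℝ (Fin m)) {N p : ℝ}
    (hN : N ≤ n * D.σmax ^ 2) (hp : p ≤ 0) :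
    2 * ((D.c - D.ψ i) * D.k x a / (D.σf ^ 2) ^ 2) *
        ((D.ψ i - 1) * (D.c - D.ψ i) * D.k x a + D.ψ i * p)
      + ((D.c - D.ψ i) * D.k x a / (D.σf ^ 2) ^ 2) ^ 2 * ((D.c - D.ψ i) ^ 2 * D.σf ^ 2 + N)
      ≤ -D.decrease i x a := by
  have hF := hs.one_le
  have hk := hκ.k_pos x a
  have hnoise := hs.noise_le hκ hσ hi hw
  have hψ := ψ_pos hκ hσ i
  have hψ1 := ψ_lt_one hκ hσ i
  have hμ := μχ_pos hκ hσ i.pos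
  have hF0 : 0 < D.σf ^ 2 := by linarith
  have hc1 : D.c - D.ψ i ≤ 1 - D.ψ i := by
    rw [c_eq hκ hσ i.pos]
    have : 0 ≤ D.μχ⁻¹ / D.σf ^ 2 := by positivity
    linarith
  unfold decrease
  generalize D.c - D.ψ i = w at *
  generalize D.σf ^ 2 = F at *
  generalize D.k x a = κ at *
  generalize D.ψ i = ψ at *
  have hw2 : w ^ 2 / F ≤ (1 - ψ) ^ 2 :=
    (div_le_self (sq_nonneg w) hF).trans (pow_le_pow_left₀ hw.le hc1 2)
  have hN' : N / F ^ 2 ≤ 1 - ψ :=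
    (div_le_div_of_nonneg_right hN (by positivity)).trans hnoise
  have hv : 0 ≤ w * κ / F ^ 2 := by positivity
  have hp' : 2 * (w * κ / F ^ 2) * (ψ * p) ≤ 0 :=
    mul_nonpos_of_nonneg_of_nonpos (by positivity) (mul_nonpos_of_nonneg_of_nonpos hψ.le hp)
  have heq : 2 * (w * κ / F ^ 2) * ((ψ - 1) * w * κ + ψ * p)
      + (w * κ / F ^ 2) ^ 2 * (w ^ 2 * F + N)
      = w ^ 2 * κ ^ 2 / F ^ 2 * (-2 * (1 - ψ) + w ^ 2 / F + N / F ^ 2)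
        + 2 * (w * κ / F ^ 2) * (ψ * p) := by
    field_simp
    ring
  have hfac : 0 ≤ w ^ 2 * κ ^ 2 / F ^ 2 := by positivity
  -- The bracket is at most −2(1 − ψ) + (1 − ψ)² + (1 − ψ) = −(1 − ψ)ψ.
  have : w ^ 2 * κ ^ 2 / F ^ 2 * (-2 * (1 - ψ) + w ^ 2 / F + N / F ^ 2)
      ≤ w ^ 2 * κ ^ 2 / F ^ 2 * (-((1 - ψ) * ψ)) :=
    mul_le_mul_of_nonneg_left (by nlinarith) hfac
  rw [heq]
  linarith

end

/-- The minimum of the local variances and the variance divided by share the same limit and cancel.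
-/
theorem tendsto_gainAt (hκ : D.KernelAssumption) (hσ : ∀ i, 0 < D.σe i) (hD : D.Setting P)
    (hd : ∀ i, Tendsto (D.dispersion i) atTop (𝓝 0)) {i : Fin n} (hw : 0 ≤ D.c - D.ψ i)
    {x a : EuclideanSpace ℝ (Fin m)} (hx : x ∈ D.Z) (ha : a ∈ D.Z) :
    Tendsto (fun t => D.gainAt i t x a) atTop
      (𝓝 ((D.c - D.ψ i) * D.k x a / (D.σf ^ 2) ^ 2)) := by
  have hV := limVar_pos hκ hσ i
  have h := (((((hD.tendsto_localVar hκ (hd i) hx).min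
    (hD.tendsto_localVar hκ (hd i) ha)).mul_const (max 0 (D.c - D.ψ i))).div_const
      (D.k x x ^ 2)).mul_const (D.k x a)).mul (tendsto_inv_localVar hκ hσ hD hd i ha)
  have heq : (D.c - D.ψ i) * D.k x a / (D.σf ^ 2) ^ 2 = min (D.limVar i) (D.limVar i)
      * max 0 (D.c - D.ψ i) / D.k x x ^ 2 * D.k x a * D.χ i := by
    rw [min_self, max_eq_right hw, hκ.k_self, χ_eq hκ hσ]
    field_simp
  rw [heq]
  exact h

theorem inner_ηL2_sum_diffNoise (hD : D.Setting P) (hη : D.GPAssumption P)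
    {x a : EuclideanSpace ℝ (Fin m)} (hx : x ∈ D.Z) (ha : a ∈ D.Z) (i : Fin n) {t : ℕ}
    (ht : 1 ≤ t) : inner ℝ (D.ηL2 P x) (∑ j, D.diffNoise P i t a j) = 0 := by
  have h : ∀ j s, 1 ≤ s → inner ℝ (D.ηL2 P x) (D.nearNoise P j s a) = 0 := fun j s hs =>
    hD.inner_ηL2_eL2 hη hx j (hD.one_le_near j hs ha)
  rw [inner_sum]
  refine Finset.sum_eq_zero fun j _ => ?_
  rw [diffNoise]
  split_ifs <;>
    simp [inner_add_right, inner_sub_right, real_inner_smul_right, h _ t ht, h _ (t + 1) (by omega)]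

theorem eventually_integral_le [IsProbabilityMeasure P] (hκ : D.KernelAssumption)
    (hσ : ∀ i, 0 < D.σe i) (hD : D.Setting P) (hη : D.GPAssumption P) (hs : D.SigmaChoice)
    (hd : ∀ i, Tendsto (D.dispersion i) atTop (𝓝 0))
    (hc : D.ConsensusAssumption) (hct : D.ConstantTransition) {i : Fin n}
    (hi : D.μχ⁻¹ ≤ D.limVar i) (hw : 0 < D.c - D.ψ i)
    {x a : EuclideanSpace ℝ (Fin m)} (hx : x ∈ D.Z) (ha : a ∈ D.Z) :
    ∀ᶠ t in atTop, ∫ ω, ((D.gainAt i t x a * (D.distMean i t a ω - D.localMean i t a ω)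
      + D.localMean i t x ω - D.η x ω) ^ 2 - (D.localMean i t x ω - D.η x ω) ^ 2) ∂P
        ≤ -(D.decrease i x a / 2) := by
  rw [← map_add_atTop_eq_nat 1, eventually_map]
  set v := (D.c - D.ψ i) * D.k x a / (D.σf ^ 2) ^ 2 with hv
  have hX := asympEq_localMean_sub_η hκ hD hη hd i hx
  have hG := (asympEq_distMean_sub_localMean hκ hσ hD hη hd hc hct i ha).smul
    ((tendsto_add_atTop_iff_nat 1).2 (tendsto_gainAt hκ hσ hD hd hw.le hx ha))
  have hlim := ((hX.tendsto_inner hG).const_mul 2).add (hG.tendsto_inner hG)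
  rw [mul_zero, add_zero] at hlim
  -- Half of the decrease is given up to absorb the asymptotic error.
  filter_upwards [hlim.eventually_lt_const (half_pos (decrease_pos hκ hσ hw x a)),
    eventually_ge_atTop 1] with t ht ht1
  have hmX : MemLp (fun ω => D.localMean i (t + 1) x ω - D.η x ω) 2 P :=
    (hD.memLp_localMean hκ hη i (t + 1) hx).sub (hη.memLp hx)
  have hmd := hD.memLp_distMean hκ hη i (t + 1) ha
  have hml := hD.memLp_localMean hκ hη i (t + 1) ha
  have hmG : MemLp (fun ω => D.distMean i (t + 1) a ω - D.localMean i (t + 1) a ω) 2 P :=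
    hmd.sub hml
  have hint := integral_sq_sub_sq hmX hmG (D.gainAt i (t + 1) x a)
  rw [toL2_sub (hD.memLp_localMean hκ hη i (t + 1) hx) (hη.memLp hx), toL2_sub hmd hml,
    ← ηL2] at hint
  simp only [add_sub_assoc]
  rw [hint]
  have hs1 := hD.one_le_near i (Nat.le_add_left 1 t) hx
  have hquad := hs.quadratic_le hκ hσ hi hw x a
    (norm_sq_sum_diffNoise_le (P := P) hκ hσ hD hi ht1 ha)
    (inner_nearNoise_sum_diffNoise_le hκ hσ hD hi hs1 ht1 ha)
  have hηN := inner_ηL2_sum_diffNoise hD hη hx ha i ht1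
  have hηN' := inner_ηL2_sum_diffNoise hD hη ha ha i ht1
  have hes := hD.inner_ηL2_eL2 hη ha i hs1
  have e1 : inner ℝ ((D.ψ i - 1) • D.ηL2 P x + D.ψ i • D.nearNoise P i (t + 1) x)
      (v • ((D.c - D.ψ i) • D.ηL2 P a + ∑ j, D.diffNoise P i t a j))
      = v * ((D.ψ i - 1) * (D.c - D.ψ i) * D.k x a
        + D.ψ i * inner ℝ (D.eL2 P i (D.near i (t + 1) x)) (∑ j, D.diffNoise P i t a j)) := by
    rw [real_inner_comm] at hes
    simp only [nearNoise, inner_add_left, inner_add_right, real_inner_smul_left,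
      real_inner_smul_right, hηN, hes, hη.inner_ηL2 hx ha]
    ring
  have e2 : inner ℝ (v • ((D.c - D.ψ i) • D.ηL2 P a + ∑ j, D.diffNoise P i t a j))
      (v • ((D.c - D.ψ i) • D.ηL2 P a + ∑ j, D.diffNoise P i t a j))
      = v ^ 2 * ((D.c - D.ψ i) ^ 2 * D.σf ^ 2 + ‖∑ j, D.diffNoise P i t a j‖ ^ 2) := by
    have hηN'' := hηN'
    rw [real_inner_comm] at hηN''
    rw [← real_inner_self_eq_norm_sq]
    simp only [inner_add_left, inner_add_right, real_inner_smul_left,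
      real_inner_smul_right, hηN', hηN'', hη.inner_ηL2 ha ha, hκ.k_self]
    ring
  rw [e1, e2] at ht
  rw [← hv] at hquad
  linarith

omit [MeasurableSpace Ω] in
/-- Fusion does not change the prediction if there is nothing to fuse with, or if all agents have
the same noise variance. -/
theorem fusedMean_eq_localMean (hκ : D.KernelAssumption) (hσ : ∀ i, 0 < D.σe i) {i : Fin n} {t : ℕ}
    (h : D.fusionSet i t = ∅ ∨ ∀ j j' : Fin n, D.σe j = D.σe j')
    (x : EuclideanSpace ℝ (Fin m)) (ω : Ω) : D.fusedMean i t x ω = D.localMean i t x ω := by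
  by_cases hE : D.fusionSet i t = ∅
  · rw [fusedMean, if_pos hE]
  · have hall := h.resolve_left hE
    have hn : (0 : ℝ) < n := by exact_mod_cast i.pos
    have hχ : ∀ j, D.χ j = D.χ i := fun j => by rw [χ, χ, hall j i]
    have hμ : D.μχ = D.χ i := by
      simp only [μχ, hχ, Finset.sum_const, Finset.card_univ, Fintype.card_fin, nsmul_eq_mul]
      field_simp
    have hc : D.c - D.ψ i = 0 := by
      rw [c_sub_ψ hκ hσ, hμ, χ_eq hκ hσ, inv_inv, sub_self, zero_div]
    rw [fusedMean, if_neg hE, v, g, hc]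
    simp

/-- Strict improvement by fusion at a single agent. -/
theorem exists_eventually_integral_le [IsProbabilityMeasure P] (hκ : D.KernelAssumption)
    (hσ : ∀ i, 0 < D.σe i) (hD : D.Setting P) (hη : D.GPAssumption P) (hs : D.SigmaChoice)
    (hd : ∀ i, Tendsto (D.dispersion i) atTop (𝓝 0))
    (hc : D.ConsensusAssumption) (hct : D.ConstantTransition) (i : Fin n) :
    ∃ C : ℝ, 0 < C ∧ ∀ x ∈ D.Z, ∀ L, SetLimit (D.fusionSet i) L → L.Nonempty →
      (∃ j j' : Fin n, D.σe j ≠ D.σe j') →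
      ∀ᶠ t in atTop, ∫ ω, ((D.fusedMean i t x ω - D.η x ω) ^ 2
        - (D.localMean i t x ω - D.η x ω) ^ 2) ∂P ≤ -(C * D.κ (Metric.infDist x D.Zagg)) := by
  by_cases hw : 0 < D.c - D.ψ i
  swap
  -- Without positive gain the hypotheses contradict each other: unequal variances put the harmonic
  -- mean strictly below the arithmetic one, which a nonempty limit puts at or below V_i.
  · refine ⟨1, one_pos, fun x _ L hL hne ⟨j, j', hj⟩ => (hw ?_).elim⟩
    rw [c_sub_ψ hκ hσ]
    refine div_pos (sub_pos.2 ?_) (by have := hκ.σf_pos; positivity)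
    exact (inv_μχ_lt hκ hσ hj).trans_le (average_le_of_mem_setLimit hκ hD hd hc hct hL hne)
  have hF := hκ.σf_pos
  -- A lower bound for the kernel on the whole input space, which makes the constant independent of
  -- the test point.
  set κ₀ := D.κ (Metric.diam D.Z) with hκ₀
  have hκ₀pos : 0 < κ₀ := hκ.pos _ Metric.diam_nonneg
  have hψ := ψ_pos hκ hσ i
  have hψ1 := sub_pos.2 (ψ_lt_one hκ hσ i)
  set B := (D.c - D.ψ i) ^ 2 * κ₀ ^ 2 / (D.σf ^ 2) ^ 2 * ((1 - D.ψ i) * D.ψ i) with hB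
  have hBpos : 0 < B := by positivity
  -- Dividing by σ_f² compensates the factor κ ≤ σ_f² in the claimed bound.
  refine ⟨B / 2 / D.σf ^ 2, by positivity, fun x hx L hL hne _ => ?_⟩
  have hi : D.μχ⁻¹ ≤ D.limVar i := (inv_μχ_le hκ hσ i.pos).trans
    (average_le_of_mem_setLimit hκ hD hd hc hct hL hne)
  -- The selected nearest point may keep changing among ties, so the estimate is made simultaneous
  -- over the finite common set.
  have hall := (Finset.eventually_all D.Zagg).2 fun a ha =>
    eventually_integral_le hκ hσ hD hη hs hd hc hct hi hw hx (hD.zagg_sub ha)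
  filter_upwards [hall, eventually_eq_of_setLimit hL, eventually_ge_atTop 1] with t ht hLt ht1
  have hne' : (D.fusionSet i t).Nonempty := hLt ▸ hne
  have hmem := (hD.nearAgg_mem i t ht1 x hx hne').1
  have hfused : ∀ ω, D.fusedMean i t x ω = D.gainAt i t x (D.nearAgg i t x)
      * (D.distMean i t (D.nearAgg i t x) ω - D.localMean i t (D.nearAgg i t x) ω)
        + D.localMean i t x ω := fun ω => by
    rw [fusedMean, if_neg hne'.ne_empty]
    rfl
  simp only [hfused]
  refine (ht _ hmem).trans (neg_le_neg ?_)
  have hk : κ₀ ≤ D.k x (D.nearAgg i t x) :=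
    hκ.anti (Set.mem_Ici.2 dist_nonneg) (Set.mem_Ici.2 Metric.diam_nonneg)
      (Metric.dist_le_diam_of_mem hD.compact.isBounded hx (hD.zagg_sub hmem))
  have hBle : B ≤ D.decrease i x (D.nearAgg i t x) := by
    rw [hB, decrease]
    gcongr
  have hκle := hκ.le _ (Metric.infDist_nonneg (x := x) (s := (D.Zagg : Set _)))
  calc B / 2 / D.σf ^ 2 * D.κ (Metric.infDist x D.Zagg)
      ≤ B / 2 / D.σf ^ 2 * D.σf ^ 2 := mul_le_mul_of_nonneg_left hκle (by positivity)
    _ = B / 2 := by field_simp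
    _ ≤ D.decrease i x (D.nearAgg i t x) / 2 := by linarith

end RaDGPR

end

/-! ### The main theorem -/

theorem mainTheorem2 {n m : ℕ} {Ω : Type*} [MeasurableSpace Ω] (P : Measure Ω)
    [IsProbabilityMeasure P] (D : RaDGPR n m Ω) (hD : D.Setting P)
    (hκ : D.KernelAssumption) (hη : D.GPAssumption P) :
    -- Part I
    (∀ ℓ : Ω → NNReal, (∀ᵐ ω ∂P, LipschitzOnWith (ℓ ω) (fun x => D.η x ω) D.Z) →
      ∀ x ∈ D.Z, ∀ i : Fin n, ∀ ε : ℝ, D.σmax < ε → ∀ t : ℕ, 1 ≤ t →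
        ∃ E : Set Ω, MeasurableSet E ∧ 1 - D.σmax ^ 2 / ε ^ 2 ≤ P.real E ∧
          ∀ ω ∈ E, |D.localMean i t x ω - D.η x ω| ≤
            (1 - D.κ (D.dispersion i t) / (D.σf ^ 2 + D.σe i ^ 2)) * D.supNorm ω
              + ℓ ω * D.dispersion i t + ε) ∧
    -- Part II
    ((∀ i, 0 < D.σe i) → D.SigmaChoice →
      (∀ i, Tendsto (D.dispersion i) atTop (𝓝 0)) →
      D.ConsensusAssumption → D.ConstantTransition →
      -- strict improvement if the limiting fusion set is nonempty
      (∃ C : ℝ, 0 < C ∧ ∀ x ∈ D.Z, ∀ i : Fin n, ∀ L, SetLimit (D.fusionSet i) L →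
        L.Nonempty → (∃ j j' : Fin n, D.σe j ≠ D.σe j') →
          (∀ t, 1 ≤ t → Integrable (fun ω => (D.fusedMean i t x ω - D.η x ω) ^ 2) P ∧
            Integrable (fun ω => (D.localMean i t x ω - D.η x ω) ^ 2) P) ∧
          limsup (fun t : ℕ => ((∫ ω, ((D.fusedMean i t x ω - D.η x ω) ^ 2
              - (D.localMean i t x ω - D.η x ω) ^ 2) ∂P : ℝ) : EReal)) atTop
            ≤ ((-(C * D.κ (Metric.infDist x D.Zagg)) : ℝ) : EReal) ∧
          -(C * D.κ (Metric.infDist x D.Zagg)) < 0) ∧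
      -- otherwise the two errors coincide from some time on
      (∀ i : Fin n, (SetLimit (D.fusionSet i) ∅ ∨ ∀ j j' : Fin n, D.σe j = D.σe j') →
        ∀ x ∈ D.Z, ∀ᶠ t in atTop, ∀ ω,
          (D.fusedMean i t x ω - D.η x ω) ^ 2 = (D.localMean i t x ω - D.η x ω) ^ 2) ∧
      -- above-average noise variance
      (∀ i : Fin n, (∑ j, D.σe j ^ 2) / n < D.σe i ^ 2 →
        SetLimit (D.fusionSet i) (D.Zagg : Set (EuclideanSpace ℝ (Fin m)))) ∧
      -- existence of the limiting fusion set away from ties of the limiting local variances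
      (∀ i : Fin n, D.σf ^ 2 * D.σe i ^ 2 / (D.σf ^ 2 + D.σe i ^ 2) ≠
          (∑ j, D.σf ^ 2 * D.σe j ^ 2 / (D.σf ^ 2 + D.σe j ^ 2)) / n →
        ∃ L, SetLimit (D.fusionSet i) L)) := by
  refine ⟨fun ℓ hℓ x hx i ε hε t ht => hD.local_accuracy hκ hℓ hx i hε ht,
    fun hσ hs hd hc hct => ⟨?_, fun i hi x hx => ?_, fun i hi => ?_, fun i hi => ?_⟩⟩
  · choose C hC0 hC using
      fun i => RaDGPR.exists_eventually_integral_le hκ hσ hD hη hs hd hc hct i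
    obtain ⟨C₀, hC₀, hle⟩ : ∃ C₀ : ℝ, 0 < C₀ ∧ ∀ i, C₀ ≤ C i := by
      rcases isEmpty_or_nonempty (Fin n) with hn | hn
      · exact ⟨1, one_pos, fun i => hn.elim i⟩
      · obtain ⟨i₀, hi₀⟩ := Finite.exists_min C
        exact ⟨C i₀, hC0 i₀, hi₀⟩
    refine ⟨C₀, hC₀, fun x hx i L hL hne hσne => ⟨fun t ht => ⟨?_, ?_⟩, ?_, ?_⟩⟩
    · exact ((hD.memLp_fusedMean hκ hη i ht hx).sub (hη.memLp hx)).integrable_sq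
    · exact ((hD.memLp_localMean hκ hη i t hx).sub (hη.memLp hx)).integrable_sq
    -- In the extended reals an eventual upper bound suffices, with no lower bound on the sequence.
    · refine limsup_le_of_le (by isBoundedDefault) ?_
      filter_upwards [hC i x hx L hL hne hσne] with t ht
      refine EReal.coe_le_coe_iff.2 (ht.trans (neg_le_neg ?_))
      exact mul_le_mul_of_nonneg_right (hle i) (hκ.pos _ Metric.infDist_nonneg).le
    · exact neg_neg_of_pos (mul_pos hC₀ (hκ.pos _ Metric.infDist_nonneg))
  · rcases hi with hL | hall
    · filter_upwards [RaDGPR.eventually_eq_of_setLimit hL] with t ht ω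
      rw [RaDGPR.fusedMean_eq_localMean hκ hσ (Or.inl ht)]
    · filter_upwards with t ω
      rw [RaDGPR.fusedMean_eq_localMean hκ hσ (Or.inr hall)]
  · exact RaDGPR.setLimit_fusionSet_zagg hκ hσ hD hd hc hct (RaDGPR.average_limVar_lt hκ hσ hi)
  · rcases lt_or_gt_of_ne hi with h | h
    · exact ⟨∅, RaDGPR.setLimit_fusionSet_empty hκ hD hd hc hct h⟩
    · exact ⟨_, RaDGPR.setLimit_fusionSet_zagg hκ hσ hD hd hc hct h⟩
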